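/- Let $d\ge 1$ be an integer. For $n\le N=2dK$ ($K$ a nonnegative integer), consider a deck of $N$ cards labelled $1,\dots,N$, where card $j$ has suit $j \bmod 2d\in\mathbb Z/2d\mathbb Z$ (so there are $K$ cards of each of the $2d$ suits). Let $\mu_{n,N}$ be the law on $(\mathbb Z/2d\mathbb Z)^n$ of the suits of the first $n$ cards after a uniformly random permutation of the deck, and let $$d_n(N)=\sum_{\omega\in(\mathbb Z/2d\mathbb Z)^n}\bigl[\mu_{n,N}(\omega)-(2d)^{-n}\bigr]^+$$ be its total variation distance to the uniform law on $(\mathbb Z/2d\mathbb Z)^n$, that is, to the law of $n$ i.i.d. uniform suits. (i) For all $n\le N=2dK$, $d_n(N)$ equals the total variation distance between the multivariate hypergeometric law of $n$ draws without replacement from a population with $K$ individuals of each of $2d$ types, with mass $\prod_{i=1}^{2d}\binom{K}{\lambda_i}\big/\binom{N}{n}$ at $\lambda$, and the multinomial law with $n$ trials and probabilities $1/(2d)$, with mass $\frac{n!}{\lambda_1!\cdots\lambda_{2d}!}(2d)^{-n}$ at $\lambda$ (here $\lambda\in\mathbb Z_{\ge 0}^{2d}$, $\lambda_1+\dots+\lambda_{2d}=n$).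 (ii) Let $c\ge 2d$ be a real number, $r=\sqrt{(4d^2-2d)(c-1)\log\frac{c}{c-1}}$, $B_r^{2d}=\{X\in\mathbb R^{2d}:\|X\|\le r\}$ (Euclidean norm), $\varPi_{2d}=\{x\in\mathbb R^{2d}:x_1+\dots+x_{2d}=0\}$, and $$\mathcal G(X)=\pi^{1/2-d}\,2^{3/2-2d}\,d^{1-d}\left[\left(\frac{c}{c-1}\right)^{d-1/2}\exp\left(-\frac{c\|X\|^2}{4d(c-1)}\right)-\exp\left(-\frac{\|X\|^2}{4d}\right)\right].$$ Then $0\le\mathcal G\le 1$ on $B_r^{2d}\cap\varPi_{2d}$, $\mathcal G$ is integrable there, and, as $n\to\infty$ along the integers $n$ for which $cn$ is an integer multiple of $2d$, $$d_n(cn)=\int_{B_r^{2d}\cap\varPi_{2d}}\mathcal G(X)\,dX+\mathcal O\left(\frac1{\sqrt n}\right),$$ where $dX=dx_1\cdots dx_{2d-1}$ is Lebesgue measure in the first $2d-1$ coordinates on the hyperplane $\varPi_{2d}$ (equivalently, the surface measure of $\varPi_{2d}$ divided by $\sqrt{2d}$), and the implied constant may depend on $d$ and $c$. -/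

import Mathlib

open MeasureTheory

noncomputable section

namespace CardDeck

/-- Total variation distance of two probability mass functions `p`, `q` on a discrete space:
the sum of the positive parts of `p x - q x`. -/
def tvDist {α : Type*} (p q : α → ℝ) : ℝ := ∑' x, max (p x - q x) 0

/-- The suit of the card with label `k` in a deck with `2d` suits: the class of `k` modulo `2d`. -/
def suit (d k : ℕ) : ZMod (2 * d) := (k : ZMod (2 * d))

/-- The suits of the first `n` cards of the deck `{1, …, N}` arranged according to the
permutation `σ`. The element `j` of `Fin N` stands for the card with label `j + 1`. -/
def firstSuits (d n N : ℕ) (h : n ≤ N) (σ : Equiv.Perm (Fin N)) : Fin n → ZMod (2 * d) :=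
  fun j => suit d ((σ (Fin.castLE h j) : ℕ) + 1)

/-- Law of the suits of the first `n` cards of a uniformly shuffled deck of `N` cards. -/
def deckLaw (d n N : ℕ) (h : n ≤ N) : PMF (Fin n → ZMod (2 * d)) :=
  (PMF.uniformOfFintype (Equiv.Perm (Fin N))).map (firstSuits d n N h)

/-- Law of `n` independent uniform suits: the uniform law on `(ℤ/2dℤ)^n`. -/
def iidLaw (d n : ℕ) [NeZero d] : PMF (Fin n → ZMod (2 * d)) :=
  PMF.uniformOfFintype (Fin n → ZMod (2 * d))

/-- The distance `d_n(N)` between the suits of the first `n` cards of a shuffled deck of `N` cards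
and `n` independent uniform suits. -/
def deckDist (d n N : ℕ) [NeZero d] (h : n ≤ N) : ℝ :=
  tvDist (fun ω => (deckLaw d n N h ω).toReal) (fun ω => (iidLaw d n ω).toReal)

/-- Mass function of the multivariate hypergeometric law: `n` draws without replacement from a
population that has `K i` individuals of type `i`. -/
def hypergeometricMass {ι : Type*} [Fintype ι] (K : ι → ℕ) (n : ℕ) (l : ι → ℕ) : ℝ :=
  if ∑ i, l i = n then (∏ i, ((K i).choose (l i) : ℝ)) / ((∑ i, K i).choose n : ℝ) else 0

/-- Mass function of the multinomial law: `n` trials with probabilities `p i`. -/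
def multinomialMass {ι : Type*} [Fintype ι] (p : ι → ℝ) (n : ℕ) (l : ι → ℕ) : ℝ :=
  if ∑ i, l i = n then (Nat.multinomial Finset.univ l : ℝ) * ∏ i, p i ^ l i else 0

/-- The hyperplane of vectors of `ℝ^m` with coordinate sum zero. -/
def hyperplane (m : ℕ) : Set (EuclideanSpace ℝ (Fin m)) := {x | ∑ i, x i = 0}

/-- The point `(y₁, …, y_{m-1}, -(y₁ + … + y_{m-1}))` of the hyperplane. -/
def hyperplanePoint (m : ℕ) (y : Fin (m - 1) → ℝ) : EuclideanSpace ℝ (Fin m) :=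
  WithLp.toLp 2 fun i => if h : (i : ℕ) < m - 1 then y ⟨i, h⟩ else -∑ j, y j

/-- The measure `dX = dx₁ ⋯ dx_{m-1}` on the hyperplane: Lebesgue measure in the first `m - 1`
coordinates (the surface measure of the hyperplane divided by `√m`). -/
def hyperplaneMeasure (m : ℕ) : Measure (EuclideanSpace ℝ (Fin m)) :=
  Measure.map (hyperplanePoint m) volume

/-- The radius `r(c)`. -/
def radius (d : ℕ) (c : ℝ) : ℝ :=
  Real.sqrt ((4 * (d : ℝ) ^ 2 - 2 * d) * (c - 1) * Real.log (c / (c - 1)))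

/-- The intersection of the hyperplane with the closed ball of radius `r(c)` in `ℝ^{2d}`. -/
def region (d : ℕ) (c : ℝ) : Set (EuclideanSpace ℝ (Fin (2 * d))) :=
  Metric.closedBall 0 (radius d c) ∩ hyperplane (2 * d)

/-- The Gaussian profile. -/
def profile (d : ℕ) (c : ℝ) (X : EuclideanSpace ℝ (Fin (2 * d))) : ℝ :=
  (Real.pi ^ (1 / 2 - (d : ℝ)) * (2 : ℝ) ^ (3 / 2 - 2 * (d : ℝ)) * (d : ℝ) ^ (1 - (d : ℝ))) *
    ((c / (c - 1)) ^ ((d : ℝ) - 1 / 2) * Real.exp (-(c * ‖X‖ ^ 2) / (4 * d * (c - 1))) -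
      Real.exp (-‖X‖ ^ 2 / (4 * d)))

end CardDeck

end

/-!
Both laws give equal mass to suit sequences with the same numbers `l` of cards of each suit, so
`d_n` is the distance between the laws of `l`, hypergeometric and multinomial. Write `m = 2d` and
rescale `l` to the point `X` with coordinates `(l i - n / m) * (m / √n)`. Stirling's formula and a
second order Taylor expansion of `log k!` show that, on bounded sets of `X`, either mass is
`(m / √n) ^ (m - 1)` times a Gaussian density on the hyperplane, with relative error `O(1 / √n)`;
the hypergeometric Gaussian is narrower than the multinomial one by the factor `c / (c - 1)` in the
exponent. For large `‖X‖` a quadratic lower bound of `log k!` makes the hypergeometric mass smaller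
than the multinomial one, so the positive part vanishes there. What remains is a Riemann sum, over
lattice cells of side `m / √n`, for the positive part of a Lipschitz difference of two Gaussians,
which is nonnegative exactly on the ball of radius `r`.
-/

namespace CardDeck

open Filter Topology

section Counting

variable {α β ι κ : Type*} [Fintype α] [Fintype β] [Fintype ι] [Fintype κ]

/-- The number of occurrences of the letter `i` in the word `ω`; as a function of `i` this is the
vector `λ` of suit counts on which the hypergeometric and multinomial laws live. -/
def letterCount [DecidableEq ι] (ω : α → ι) (i : ι) : ℕ := Fintype.card {a // ω a = i}

/-- Injections compatible with two colourings, seen as families of injections between the colour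
classes; this is what makes them countable class by class. -/
def colourEmbeddingEquiv {α β ι : Type*} (col : β → ι) (ω : α → ι) :
    {e : α ↪ β // ∀ a, col (e a) = ω a} ≃
      ∀ s : ι, ({a // ω a = s} ↪ {b // col b = s}) where
  toFun e s := ⟨fun a => ⟨e.1 a.1, (e.2 a.1).trans a.2⟩, fun _ _ h =>
    Subtype.ext (e.1.injective (congrArg Subtype.val h))⟩
  invFun F := ⟨⟨fun a => (F (ω a) ⟨a, rfl⟩).1, fun a a' h => by
    have injective_of_eq : ∀ (s s' : ι) (x : {a // ω a = s}) (x' : {a // ω a = s'}), s = s' →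
        (F s x).1 = (F s' x').1 → x.1 = x'.1 := by
      rintro s _ x x' rfl hx
      exact congrArg Subtype.val ((F s).injective (Subtype.ext hx))
    have same_colour : ω a = ω a' := by
      rw [← (F (ω a) ⟨a, rfl⟩).2, ← (F (ω a') ⟨a', rfl⟩).2]
      exact congrArg col h
    exact injective_of_eq _ _ ⟨a, rfl⟩ ⟨a', rfl⟩ same_colour h⟩, fun a => (F (ω a) ⟨a, rfl⟩).2⟩
  left_inv e := by ext a; rfl
  right_inv F := by
    funext s
    ext ⟨a, ha⟩
    subst ha
    rfl

lemma card_colourEmbedding [DecidableEq ι] (col : β → ι) (ω : α → ι) :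
    Fintype.card {e : α ↪ β // ∀ a, col (e a) = ω a} =
      ∏ s, (letterCount col s).descFactorial (letterCount ω s) := by
  rw [Fintype.card_congr (colourEmbeddingEquiv col ω), Fintype.card_pi]
  exact Finset.prod_congr rfl fun s _ => Fintype.card_embedding_eq

lemma card_perm_trans_eq_congr [DecidableEq β] (i e e' : α ↪ β) :
    Fintype.card {σ : Equiv.Perm β // i.trans σ.toEmbedding = e} =
      Fintype.card {σ : Equiv.Perm β // i.trans σ.toEmbedding = e'} := by
  obtain ⟨τ, hτ⟩ := Equiv.Perm.exists_extending_pair e e' e.injective e'.injective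
  have hτe : e' = e.trans τ.toEmbedding := by ext a; exact (hτ a).symm
  refine Fintype.card_congr ((Equiv.mulLeft τ).subtypeEquiv fun σ => ?_)
  simp only [hτe, DFunLike.ext_iff, Function.Embedding.trans_apply, Equiv.toEmbedding_apply,
    Equiv.coe_mulLeft, Equiv.Perm.mul_apply, EmbeddingLike.apply_eq_iff_eq]

lemma card_perm_trans_eq_mul [DecidableEq β] (i : α ↪ β) (P : (α ↪ β) → Prop)
    [DecidablePred P] :
    Fintype.card {σ : Equiv.Perm β // P (i.trans σ.toEmbedding)} =
      Fintype.card {e : α ↪ β // P e} *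
        Fintype.card {σ : Equiv.Perm β // i.trans σ.toEmbedding = i} := by
  have fibres := Finset.sum_card_fiberwise_eq_card_filter Finset.univ
    (Finset.univ.filter P) fun σ : Equiv.Perm β => i.trans σ.toEmbedding
  simp only [← Fintype.card_subtype, card_perm_trans_eq_congr i _ i, Finset.sum_const,
    smul_eq_mul, Finset.mem_filter, Finset.mem_univ, true_and] at fibres
  exact fibres.symm

lemma card_perm_trans_mul_descFactorial [DecidableEq β] (i : α ↪ β) (P : (α ↪ β) → Prop)
    [DecidablePred P] :
    Fintype.card {σ : Equiv.Perm β // P (i.trans σ.toEmbedding)} *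
      (Fintype.card β).descFactorial (Fintype.card α) =
      (Fintype.card β).factorial * Fintype.card {e : α ↪ β // P e} := by
  have all_perms := card_perm_trans_eq_mul i fun _ => True
  simp only [Fintype.card_subtype_true, Fintype.card_perm, Fintype.card_embedding_eq] at all_perms
  rw [card_perm_trans_eq_mul i P, all_perms]
  ring

lemma card_perm_colouring_mul_descFactorial [DecidableEq ι] (i : α ↪ β) (col : β → ι)
    (ω : α → ι) :
    Nat.card {σ : Equiv.Perm β // ∀ a, col (σ (i a)) = ω a} *
      (Fintype.card β).descFactorial (Fintype.card α) =
      (Fintype.card β).factorial * ∏ s, (letterCount col s).descFactorial (letterCount ω s) := by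
  classical
  rw [← card_colourEmbedding, Nat.card_eq_fintype_card]
  exact card_perm_trans_mul_descFactorial i fun e => ∀ a, col (e a) = ω a

lemma card_letterCount_eq_multinomial [DecidableEq α] [DecidableEq ι] {l : ι → ℕ}
    (hl : ∑ i, l i = Fintype.card α) :
    Fintype.card {ω : α → ι // letterCount ω = l} = Nat.multinomial Finset.univ l := by
  -- Compare the coefficients of `X ^ l` in two expansions of `(∑ i, X i) ^ Fintype.card α`.
  have monomial_eq : ∀ k : ι → ℕ, ∏ i, (MvPolynomial.X i : MvPolynomial ι ℕ) ^ k i =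
      MvPolynomial.monomial (Finsupp.equivFunOnFinite.symm k) 1 := fun k => by
    simp [MvPolynomial.monomial_eq, Finsupp.prod_fintype]
  have word_eq : ∀ ω : α → ι, ∏ a, (MvPolynomial.X (ω a) : MvPolynomial ι ℕ) =
      MvPolynomial.monomial (Finsupp.equivFunOnFinite.symm (letterCount ω)) 1 := fun ω => by
    rw [← monomial_eq, ← Finset.prod_fiberwise (s := Finset.univ) (g := ω)]
    refine Finset.prod_congr rfl fun i _ => ?_
    rw [letterCount, Fintype.card_subtype]
    exact Finset.prod_eq_pow_card fun a ha => by rw [(Finset.mem_filter.1 ha).2]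
  have expansion := Finset.sum_pow_eq_sum_piAntidiag (Finset.univ : Finset ι)
    (fun i => (MvPolynomial.X i : MvPolynomial ι ℕ)) (Fintype.card α)
  rw [← Finset.card_univ, ← Finset.prod_const, Finset.prod_univ_sum] at expansion
  simp only [Fintype.piFinset_univ, word_eq, monomial_eq] at expansion
  have coeff_eq := congrArg (MvPolynomial.coeff (Finsupp.equivFunOnFinite.symm l)) expansion
  simp only [MvPolynomial.coeff_sum, ← MvPolynomial.C_eq_coe_nat, MvPolynomial.coeff_C_mul,
    MvPolynomial.coeff_monomial, EmbeddingLike.apply_eq_iff_eq, Finset.sum_boole, mul_ite, mul_one,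
    mul_zero, Finset.sum_ite_eq', Nat.cast_id, Finset.card_univ] at coeff_eq
  rwa [if_pos (by simp [hl]), ← Fintype.card_subtype] at coeff_eq

lemma sum_letterCount [DecidableEq ι] (ω : α → ι) : ∑ i, letterCount ω i = Fintype.card α := by
  simp only [letterCount, Fintype.card_subtype]
  exact (Finset.card_eq_sum_card_fiberwise fun _ _ => Finset.mem_coe.2 (Finset.mem_univ _)).symm

lemma sum_comp_letterCount [DecidableEq α] [DecidableEq ι] (F : (ι → ℕ) → ℝ) :
    ∑ ω : α → ι, F (letterCount ω) =
      ∑ l ∈ Finset.piAntidiag (Finset.univ : Finset ι) (Fintype.card α),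
        (Nat.multinomial Finset.univ l : ℝ) * F l := by
  rw [← Finset.sum_fiberwise_of_maps_to (g := letterCount)
    (t := Finset.piAntidiag Finset.univ (Fintype.card α)) (by simp [sum_letterCount])]
  refine Finset.sum_congr rfl fun l hl => ?_
  rw [← card_letterCount_eq_multinomial (α := α) (by simpa using hl), Fintype.card_subtype,
    ← nsmul_eq_mul, ← Finset.sum_const]
  exact Finset.sum_congr rfl fun ω hω => by rw [(Finset.mem_filter.1 hω).2]

lemma hypergeometricMass_const {n : ℕ} (K : ℕ) {l : ι → ℕ} (hl : ∑ i, l i = n) :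
    hypergeometricMass (fun _ : ι => K) n l =
      (Nat.multinomial Finset.univ l : ℝ) *
        ((∏ i, (K.descFactorial (l i) : ℝ)) / ((Fintype.card ι * K).descFactorial n : ℝ)) := by
  have hspec :
      (∏ i, ((l i).factorial : ℝ)) * (Nat.multinomial Finset.univ l : ℝ) = n.factorial := by
    rw [← hl]; exact_mod_cast Nat.multinomial_spec Finset.univ l
  have hn : (n.factorial : ℝ) ≠ 0 := by positivity
  simp only [hypergeometricMass, hl, if_true, Finset.sum_const, Finset.card_univ, smul_eq_mul,
    Nat.descFactorial_eq_factorial_mul_choose, Nat.cast_mul, Finset.prod_mul_distrib]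
  rw [← mul_div_assoc, ← mul_assoc, mul_comm (Nat.multinomial _ _ : ℝ), hspec,
    mul_div_mul_left _ _ hn]

lemma multinomialMass_const {n : ℕ} (p : ℝ) {l : ι → ℕ} (hl : ∑ i, l i = n) :
    multinomialMass (fun _ : ι => p) n l = (Nat.multinomial Finset.univ l : ℝ) * p ^ n := by
  simp [multinomialMass, hl, Finset.prod_pow_eq_pow_sum]

lemma tvDist_hypergeometric_multinomial_eq_sum [DecidableEq ι] (n K : ℕ) (p : ℝ) :
    tvDist (hypergeometricMass (fun _ : ι => K) n) (multinomialMass (fun _ : ι => p) n) =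
      ∑ l ∈ Finset.piAntidiag (Finset.univ : Finset ι) n,
        max (hypergeometricMass (fun _ : ι => K) n l - multinomialMass (fun _ : ι => p) n l) 0 := by
  rw [tvDist, tsum_eq_sum]
  intro l hl
  have hsum : ¬ ∑ i, l i = n := by simpa using hl
  simp [hypergeometricMass, multinomialMass, hsum]

lemma tvDist_hypergeometric_multinomial_congr (e : ι ≃ κ) (n K : ℕ) (p : ℝ) :
    tvDist (hypergeometricMass (fun _ : ι => K) n) (multinomialMass (fun _ : ι => p) n) =
      tvDist (hypergeometricMass (fun _ : κ => K) n) (multinomialMass (fun _ : κ => p) n) := by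
  refine (Equiv.tsum_eq (e.arrowCongr (Equiv.refl ℕ)) _).symm.trans (tsum_congr fun l => ?_) |>.symm
  simp [hypergeometricMass, multinomialMass, Nat.multinomial, Equiv.arrowCongr,
    Fintype.card_congr e, e.symm.sum_comp l, e.symm.prod_comp fun i => (K.choose (l i) : ℝ),
    e.symm.prod_comp fun i => (l i).factorial, e.symm.prod_comp fun i => p ^ l i]

end Counting

section Deck

variable (d : ℕ) [NeZero d]

lemma letterCount_suit (K : ℕ) (s : ZMod (2 * d)) :
    letterCount (fun x : Fin (2 * d * K) => suit d ((x : ℕ) + 1)) s = K := by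
  have residue : ∀ k : ℕ, suit d (k + 1) = s ↔ k ≡ (s - 1).val [MOD 2 * d] := fun k => by
    rw [← ZMod.natCast_eq_natCast_iff, ZMod.natCast_zmod_val, suit, Nat.cast_succ,
      eq_sub_iff_add_eq]
  have count := Nat.count_modEq_card (2 * d * K) (Nat.pos_of_neZero (2 * d)) (s - 1).val
  simp only [Nat.mul_mod_right, not_lt_zero, if_false, add_zero,
    Nat.mul_div_cancel_left _ (Nat.pos_of_neZero (2 * d))] at count
  refine Eq.trans ?_ count
  rw [letterCount, Nat.count_eq_card_filter_range, Fintype.card_subtype, ← Nat.Iio_eq_range,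
    ← Fin.map_valEmbedding_univ, Finset.filter_map, Finset.card_map]
  exact congrArg Finset.card (Finset.filter_congr fun x _ => residue _)

theorem deckLaw_toReal (n K : ℕ) (h : n ≤ 2 * d * K) (ω : Fin n → ZMod (2 * d)) :
    (deckLaw d n (2 * d * K) h ω).toReal =
      (∏ s, (K.descFactorial (letterCount ω s) : ℝ)) / ((2 * d * K).descFactorial n : ℝ) := by
  have card_eq := card_perm_colouring_mul_descFactorial (Fin.castLEEmb h)
    (fun x : Fin (2 * d * K) => suit d ((x : ℕ) + 1)) ω
  simp only [letterCount_suit, Fintype.card_fin] at card_eq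
  have law_eq : deckLaw d n (2 * d * K) h ω =
      (Nat.card {σ : Equiv.Perm (Fin (2 * d * K)) //
        ∀ a, suit d ((σ (Fin.castLEEmb h a) : ℕ) + 1) = ω a} : ENNReal) *
        ((2 * d * K).factorial : ENNReal)⁻¹ := by
    rw [deckLaw, PMF.map_apply, tsum_fintype]
    simp only [PMF.uniformOfFintype_apply, Fintype.card_perm, Fintype.card_fin]
    rw [← Finset.sum_filter, Finset.sum_const, nsmul_eq_mul,
      Nat.card_eq_fintype_card, Fintype.card_subtype]
    congr 3
    ext σ
    simp [firstSuits, funext_iff, eq_comm]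
  have hdesc : ((2 * d * K).descFactorial n : ℝ) ≠ 0 := by
    exact_mod_cast (Nat.descFactorial_pos.2 h).ne'
  have hfact : ((2 * d * K).factorial : ℝ) ≠ 0 := by positivity
  rw [law_eq, ENNReal.toReal_mul, ENNReal.toReal_inv, ENNReal.toReal_natCast,
    ENNReal.toReal_natCast, eq_div_iff hdesc, mul_right_comm, ← div_eq_mul_inv,
    div_eq_iff hfact, mul_comm (∏ _, _)]
  exact_mod_cast card_eq

theorem deckDist_eq_tvDist (n K : ℕ) (h : n ≤ 2 * d * K) :
    deckDist d n (2 * d * K) h =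
      tvDist (hypergeometricMass (fun _ : Fin (2 * d) => K) n)
        (multinomialMass (fun _ : Fin (2 * d) => 1 / (2 * (d : ℝ))) n) := by
  have e : Fin (2 * d) ≃ ZMod (2 * d) := Fintype.equivOfCardEq (by simp [ZMod.card])
  have iid : ∀ ω, (iidLaw d n ω).toReal = (1 / (2 * (d : ℝ))) ^ n := fun ω => by
    simp [iidLaw, PMF.uniformOfFintype_apply, ZMod.card, ← inv_pow, mul_comm]
  rw [tvDist_hypergeometric_multinomial_congr e, tvDist_hypergeometric_multinomial_eq_sum, deckDist,
    tvDist, tsum_fintype]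
  simp only [deckLaw_toReal, iid]
  refine (sum_comp_letterCount fun l => max ((∏ s, (K.descFactorial (l s) : ℝ)) /
    ((2 * d * K).descFactorial n : ℝ) - (1 / (2 * (d : ℝ))) ^ n) 0).trans ?_
  rw [Fintype.card_fin]
  refine Finset.sum_congr rfl fun l hl => ?_
  have hl : ∑ s, l s = n := by simpa using hl
  rw [hypergeometricMass_const K hl, multinomialMass_const _ hl, ZMod.card, ← mul_sub,
    mul_max_of_nonneg _ _ (Nat.cast_nonneg _), mul_zero]

end Deck

section Stirling

/-- The main term of Stirling's approximation to `log z!`, as a function of a real variable. -/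
noncomputable def stirlingMain (z : ℝ) : ℝ :=
  (z + 1 / 2) * Real.log z - z + Real.log (2 * Real.pi) / 2

/-- The second order expansion of Stirling's approximation to `log x!` around `x = a`, with the
`O(1 / a)` corrections to the first two derivatives of `stirlingMain` dropped. -/
noncomputable def stirlingTaylor (a x : ℝ) : ℝ :=
  stirlingMain a + (x - a) * Real.log a + (x - a) ^ 2 / (2 * a)

lemma log_stirlingSeq_le {k : ℕ} (hk : k ≠ 0) :
    Real.log (Stirling.stirlingSeq k) ≤ Real.log Real.pi / 2 + 1 / (12 * k) := by
  obtain ⟨j, rfl⟩ := Nat.exists_eq_succ_of_ne_zero hk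
  have hmono : Monotone fun i : ℕ =>
      Real.log (Stirling.stirlingSeq (i + 1)) - 1 / (12 * ((i : ℝ) + 1)) := by
    refine monotone_nat_of_le_succ fun i => ?_
    have telescope : (1 : ℝ) / (12 * ((i + 1 : ℕ) : ℝ) * (((i + 1 : ℕ) : ℝ) + 1)) =
        1 / (12 * ((i : ℝ) + 1)) - 1 / (12 * (((i + 1 : ℕ) : ℝ) + 1)) := by
      push_cast
      field_simp
      ring
    linarith [telescope ▸ Stirling.log_stirlingSeq_sdiff_le (i + 1)]
  have hlim : Tendsto (fun i : ℕ => Real.log (Stirling.stirlingSeq (i + 1)) -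
      1 / (12 * ((i : ℝ) + 1))) atTop (𝓝 (Real.log (Real.sqrt Real.pi) - 0)) := by
    refine Tendsto.sub ((Stirling.tendsto_stirlingSeq_sqrt_pi.comp
      (tendsto_add_atTop_nat 1)).log (by positivity)) ?_
    have := (tendsto_one_div_add_atTop_nhds_zero_nat (𝕜 := ℝ)).const_mul (1 / 12)
    rw [mul_zero] at this
    exact this.congr fun i => by field_simp
  have hle := hmono.ge_of_tendsto hlim j
  rw [Real.log_sqrt Real.pi_pos.le, sub_zero] at hle
  rw [Nat.cast_succ]
  linarith

lemma stirlingMain_le_log_factorial {k : ℕ} (hk : k ≠ 0) :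
    stirlingMain k ≤ Real.log k.factorial := by
  have := Stirling.le_log_factorial_stirling hk
  rw [stirlingMain]
  linarith

lemma abs_log_factorial_sub_stirlingMain_le {k : ℕ} (hk : k ≠ 0) :
    |Real.log k.factorial - stirlingMain k| ≤ 1 / k := by
  have hk' : (0 : ℝ) < k := by positivity
  have upper := log_stirlingSeq_le hk
  rw [Stirling.log_stirlingSeq_formula, Real.log_mul two_ne_zero hk'.ne',
    Real.log_div hk'.ne' (Real.exp_pos 1).ne', Real.log_exp] at upper
  have constant_le : (1 : ℝ) / (12 * k) ≤ 1 / k := by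
    gcongr; linarith
  rw [abs_of_nonneg (sub_nonneg.2 (stirlingMain_le_log_factorial hk)), stirlingMain,
    Real.log_mul two_ne_zero Real.pi_ne_zero]
  linarith

lemma abs_log_one_add_le {u : ℝ} (hu : |u| ≤ 1 / 2) : |Real.log (1 + u)| ≤ 2 * |u| := by
  have h := Real.abs_log_sub_add_sum_range_le (x := -u) (by rw [abs_neg]; linarith) 0
  simp only [Finset.range_zero, Finset.sum_empty, zero_add, sub_neg_eq_add, abs_neg, pow_one] at h
  refine h.trans ?_
  rw [div_le_iff₀ (by linarith)]
  nlinarith [abs_nonneg u]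

lemma abs_one_add_mul_log_one_add_sub_le {u : ℝ} (hu : |u| ≤ 1 / 2) :
    |(1 + u) * Real.log (1 + u) - u - u ^ 2 / 2| ≤ 4 * |u| ^ 3 := by
  have hu0 := abs_nonneg u
  have log_expansion : |Real.log (1 + u) - u + u ^ 2 / 2| ≤ 2 * |u| ^ 3 := by
    have h := Real.abs_log_sub_add_sum_range_le (x := -u) (by rw [abs_neg]; linarith) 2
    simp only [Finset.sum_range_succ, Finset.range_zero, Finset.sum_empty, zero_add,
      sub_neg_eq_add, abs_neg, Nat.cast_zero, Nat.cast_one, pow_one, div_one, neg_sq,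
      one_add_one_eq_two, Nat.reduceAdd] at h
    rw [show Real.log (1 + u) - u + u ^ 2 / 2 = -u + u ^ 2 / 2 + Real.log (1 + u) by ring]
    refine h.trans ?_
    rw [div_le_iff₀ (by linarith)]
    nlinarith [pow_nonneg hu0 3]
  calc |(1 + u) * Real.log (1 + u) - u - u ^ 2 / 2|
      = |(1 + u) * (Real.log (1 + u) - u + u ^ 2 / 2) - u ^ 3 / 2| := by congr 1; ring
    _ ≤ |1 + u| * |Real.log (1 + u) - u + u ^ 2 / 2| + |u| ^ 3 / 2 := by
        rw [← abs_mul, ← abs_pow, ← abs_two (α := ℝ), ← abs_div, abs_two]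
        exact abs_sub _ _
    _ ≤ (3 / 2) * (2 * |u| ^ 3) + |u| ^ 3 / 2 := by
        gcongr
        linarith [abs_add_le 1 u, abs_one (α := ℝ)]
    _ ≤ 4 * |u| ^ 3 := by nlinarith [pow_nonneg hu0 3]

lemma abs_stirlingMain_sub_stirlingTaylor_le {a x : ℝ} (ha : 0 < a) (hx : |x - a| ≤ a / 2) :
    |stirlingMain x - stirlingTaylor a x| ≤ |x - a| / a + 4 * |x - a| ^ 3 / a ^ 2 := by
  obtain ⟨u, rfl⟩ : ∃ u, x = a * (1 + u) := ⟨x / a - 1, by field_simp; ring⟩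
  have hxa : |a * (1 + u) - a| = a * |u| := by
    rw [show a * (1 + u) - a = a * u by ring, abs_mul, abs_of_pos ha]
  rw [hxa] at hx ⊢
  have hu : |u| ≤ 1 / 2 := by nlinarith
  have hu_pos : 0 < 1 + u := by linarith [(abs_le.1 hu).1]
  have hdiff : stirlingMain (a * (1 + u)) - stirlingTaylor a (a * (1 + u)) =
      Real.log (1 + u) / 2 + a * ((1 + u) * Real.log (1 + u) - u - u ^ 2 / 2) := by
    rw [stirlingTaylor, stirlingMain, stirlingMain, Real.log_mul ha.ne' hu_pos.ne']
    field_simp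
    ring
  calc |stirlingMain (a * (1 + u)) - stirlingTaylor a (a * (1 + u))|
      ≤ |Real.log (1 + u)| / 2 + a * |(1 + u) * Real.log (1 + u) - u - u ^ 2 / 2| := by
        rw [hdiff]
        refine (abs_add_le _ _).trans_eq ?_
        rw [abs_div, abs_two, abs_mul, abs_of_pos ha]
    _ ≤ 2 * |u| / 2 + a * (4 * |u| ^ 3) := by
        gcongr
        exacts [abs_log_one_add_le hu, abs_one_add_mul_log_one_add_sub_le hu]
    _ = a * |u| / a + 4 * (a * |u|) ^ 3 / a ^ 2 := by field_simp

lemma abs_log_factorial_sub_stirlingTaylor_le {a : ℝ} {k : ℕ} (ha : 0 < a)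
    (hk : |(k : ℝ) - a| ≤ a / 2) :
    |Real.log k.factorial - stirlingTaylor a k| ≤
      2 / a + (|(k : ℝ) - a| / a + 4 * |(k : ℝ) - a| ^ 3 / a ^ 2) := by
  have hak : a / 2 ≤ k := by linarith [(abs_le.1 hk).1]
  have hk0 : k ≠ 0 := by rintro rfl; norm_num at hak; linarith
  have hinv : (1 : ℝ) / k ≤ 2 / a := by
    rw [div_le_div_iff₀ (by positivity) ha]; linarith
  exact (abs_sub_le _ (stirlingMain k) _).trans <|
    add_le_add ((abs_log_factorial_sub_stirlingMain_le hk0).trans hinv)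
      (abs_stirlingMain_sub_stirlingTaylor_le ha hk)

lemma eventually_le_sqrt_natCast (x : ℝ) : ∀ᶠ n : ℕ in atTop, x ≤ Real.sqrt n :=
  (Real.tendsto_sqrt_atTop.comp tendsto_natCast_atTop_atTop).eventually_ge_atTop x

lemma exists_abs_log_factorial_sub_stirlingTaylor_le {α : ℝ} (hα : 0 < α) (R : ℝ) :
    ∃ C, ∀ᶠ n : ℕ in atTop, ∀ k : ℕ, |(k : ℝ) - α * n| ≤ R * Real.sqrt n →
      |Real.log k.factorial - stirlingTaylor (α * n) k| ≤ C / Real.sqrt n := by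
  refine ⟨2 / α + (R / α + 4 * R ^ 3 / α ^ 2), ?_⟩
  filter_upwards [eventually_le_sqrt_natCast 1, eventually_le_sqrt_natCast (2 * R / α)]
    with n hn hnR k hk
  set s := Real.sqrt n
  have hs : (n : ℝ) = s ^ 2 := (Real.sq_sqrt n.cast_nonneg).symm
  have hs0 : 0 < s := by linarith
  rw [hs] at hk ⊢
  have hR : R * s ≤ α * s ^ 2 / 2 := by
    rw [div_le_iff₀ hα] at hnR
    nlinarith
  calc _ ≤ _ := abs_log_factorial_sub_stirlingTaylor_le (by positivity) (hk.trans hR)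
    _ ≤ 2 / (α * s) + (R * s / (α * s ^ 2) + 4 * (R * s) ^ 3 / (α * s ^ 2) ^ 2) := by
        gcongr
        nlinarith
    _ = _ := by field_simp

lemma exists_abs_sum_log_factorial_sub_le (ι : Type*) [Fintype ι] {α : ℝ} (hα : 0 < α) (R : ℝ) :
    ∃ C, ∀ᶠ n : ℕ in atTop, ∀ k : ι → ℕ, (∀ i, |(k i : ℝ) - α * n| ≤ R * Real.sqrt n) →
      ∑ i, ((k i : ℝ) - α * n) = 0 →
      |∑ i, Real.log (k i).factorial - (Fintype.card ι * stirlingMain (α * n) +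
        (∑ i, ((k i : ℝ) - α * n) ^ 2) / (2 * (α * n)))| ≤ C / Real.sqrt n := by
  obtain ⟨C, hC⟩ := exists_abs_log_factorial_sub_stirlingTaylor_le hα R
  refine ⟨Fintype.card ι * C, hC.mono fun n hn k hk hsum => ?_⟩
  calc _ = |∑ i, (Real.log (k i).factorial - stirlingTaylor (α * n) (k i))| := by
        simp only [stirlingTaylor, Finset.sum_sub_distrib, Finset.sum_add_distrib,
          ← Finset.sum_mul, ← Finset.sum_div, hsum, Finset.sum_const, Finset.card_univ,
          nsmul_eq_mul, zero_mul, add_zero]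
    _ ≤ ∑ _i : ι, C / Real.sqrt n :=
        (Finset.abs_sum_le_sum_abs _ _).trans (Finset.sum_le_sum fun i _ => hn _ (hk i))
    _ = Fintype.card ι * C / Real.sqrt n := by
        rw [Finset.sum_const, Finset.card_univ, nsmul_eq_mul, mul_div_assoc]

lemma log_factorial_succ (k : ℕ) :
    Real.log (k + 1).factorial = Real.log (k + 1 : ℝ) + Real.log k.factorial := by
  rw [Nat.factorial_succ, Nat.cast_mul, Real.log_mul (by positivity) (by positivity),
    Nat.cast_succ]

/-- `log k!` minus a line of slope `log a` and a parabola of curvature `1 / M`. The summand `1` in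
`k - a + 1` puts the discrete minimum of the parabola at `⌊a⌋`, where `log k! - k log a` is minimal
too. -/
noncomputable def logFactorialExcess (a M : ℝ) (k : ℕ) : ℝ :=
  Real.log k.factorial - k * Real.log a - (k - a) * (k - a + 1) / (2 * M)

lemma logFactorialExcess_succ_sub (a M : ℝ) (k : ℕ) :
    logFactorialExcess a M (k + 1) - logFactorialExcess a M k =
      Real.log (k + 1) - Real.log a - (k + 1 - a) / M := by
  rw [logFactorialExcess, logFactorialExcess, log_factorial_succ]
  push_cast
  ring

lemma logFactorialExcess_le_succ {a M : ℝ} {k : ℕ} (ha : 0 < a) (hak : a ≤ k + 1)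
    (hkM : (k : ℝ) + 1 ≤ M) : logFactorialExcess a M k ≤ logFactorialExcess a M (k + 1) := by
  rw [← sub_nonneg, logFactorialExcess_succ_sub, sub_nonneg]
  calc (k + 1 - a) / M ≤ (k + 1 - a) / (k + 1) :=
        div_le_div_of_nonneg_left (by linarith) (by positivity) hkM
    _ = 1 - ((k + 1) / a)⁻¹ := by field_simp
    _ ≤ Real.log ((k + 1) / a) := Real.one_sub_inv_le_log_of_pos (by positivity)
    _ = Real.log (k + 1) - Real.log a := Real.log_div (by positivity) ha.ne'

lemma logFactorialExcess_succ_le {a M : ℝ} {k : ℕ} (hka : (k : ℝ) + 1 ≤ a) (haM : a ≤ M) :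
    logFactorialExcess a M (k + 1) ≤ logFactorialExcess a M k := by
  have ha : 0 < a := by linarith [k.cast_nonneg (α := ℝ)]
  rw [← sub_nonpos, logFactorialExcess_succ_sub, sub_nonpos]
  calc Real.log (k + 1) - Real.log a = Real.log ((k + 1) / a) :=
        (Real.log_div (by positivity) ha.ne').symm
    _ ≤ (k + 1) / a - 1 := Real.log_le_sub_one_of_pos (by positivity)
    _ = -((a - (k + 1)) / a) := by field_simp; ring
    _ ≤ -((a - (k + 1)) / M) :=
        neg_le_neg (div_le_div_of_nonneg_left (by linarith) ha haM)
    _ = (k + 1 - a) / M := by ring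

lemma logFactorialExcess_floor_le {a : ℝ} {k M : ℕ} (ha : 0 < a) (haM : a ≤ M) (hkM : k ≤ M) :
    logFactorialExcess a M ⌊a⌋₊ ≤ logFactorialExcess a M k := by
  rcases le_total ⌊a⌋₊ k with hk | hk
  · induction k, hk using Nat.le_induction with
    | base => exact le_rfl
    | succ k hk ih =>
      refine (ih (by omega)).trans (logFactorialExcess_le_succ ha ?_ (by exact_mod_cast hkM))
      exact (Nat.lt_floor_add_one a).le.trans (by gcongr)
  · induction hk using Nat.decreasingInduction with
    | self => exact le_rfl
    | of_succ k hk ih =>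
      refine (ih ?_).trans (logFactorialExcess_succ_le ?_ haM)
      · exact Nat.succ_le_of_lt (hk.trans_le (Nat.floor_le_of_le haM))
      · exact_mod_cast (Nat.le_floor_iff ha.le).1 hk

lemma stirlingMain_floor_ge {a : ℝ} (ha : 1 ≤ a) :
    stirlingMain a + (⌊a⌋₊ - a) * Real.log a - 1 / 2 ≤ stirlingMain ⌊a⌋₊ := by
  have ha0 : 0 < a := by linarith
  set j : ℝ := (⌊a⌋₊ : ℝ)
  have hj : 1 ≤ j := Nat.one_le_cast.2 ((Nat.one_le_floor_iff a).2 ha)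
  have haj : a < j + 1 := Nat.lt_floor_add_one a
  have hlog : 1 - a / j ≤ Real.log j - Real.log a := by
    rw [← Real.log_div (by positivity) ha0.ne', ← inv_div]
    exact Real.one_sub_inv_le_log_of_pos (by positivity)
  have hmul : (j + 1 / 2) * (1 - a / j) + (a - j) = -((a - j) / (2 * j)) := by
    field_simp; ring
  have hfrac : (a - j) / (2 * j) ≤ 1 / 2 := by
    rw [div_le_div_iff₀ (by positivity) two_pos]; linarith
  rw [stirlingMain, stirlingMain]
  nlinarith [mul_le_mul_of_nonneg_left hlog (by positivity : 0 ≤ j + 1 / 2)]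

lemma le_log_factorial_of_le {a : ℝ} {k M : ℕ} (ha : 1 ≤ a) (haM : a ≤ M) (hkM : k ≤ M) :
    stirlingMain a + (k - a) * Real.log a + (k - a) * (k - a + 1) / (2 * M) - 1 / 2 ≤
      Real.log k.factorial := by
  have ha0 : 0 < a := by linarith
  have hmin := logFactorialExcess_floor_le ha0 haM hkM
  have hfloor := stirlingMain_le_log_factorial (Nat.floor_pos.2 ha).ne'
  have hparabola : ((⌊a⌋₊ : ℝ) - a) * (⌊a⌋₊ - a + 1) / (2 * M) ≤ 0 :=
    div_nonpos_of_nonpos_of_nonneg (mul_nonpos_of_nonpos_of_nonneg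
      (by linarith [Nat.floor_le ha0.le]) (by linarith [Nat.lt_floor_add_one a])) (by positivity)
  rw [logFactorialExcess, logFactorialExcess] at hmin
  linarith [stirlingMain_floor_ge ha]

end Stirling

section Gaussian

variable {m : ℕ}

/-- The density, with respect to `hyperplaneMeasure m`, of the centred Gaussian law on the
hyperplane whose covariance is `m / θ` times the orthogonal projection. The value `θ = 1` belongs to
the multinomial law and `θ = c / (c - 1)` to the hypergeometric law. -/
noncomputable def hyperplaneGaussian (m : ℕ) (θ : ℝ) (X : EuclideanSpace ℝ (Fin m)) : ℝ :=
  Real.sqrt m * (θ / (2 * Real.pi * m)) ^ (((m : ℝ) - 1) / 2) * Real.exp (-(θ * ‖X‖ ^ 2) / (2 * m))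

lemma hyperplaneGaussian_pos [NeZero m] {θ : ℝ} (hθ : 0 < θ) (X : EuclideanSpace ℝ (Fin m)) :
    0 < hyperplaneGaussian m θ X := by
  have hm : (0 : ℝ) < m := Nat.cast_pos.2 (NeZero.pos m)
  rw [hyperplaneGaussian]
  positivity

lemma log_hyperplaneGaussian [NeZero m] {θ : ℝ} (hθ : 0 < θ) (X : EuclideanSpace ℝ (Fin m)) :
    Real.log (hyperplaneGaussian m θ X) = Real.log m / 2 +
      ((m : ℝ) - 1) / 2 * (Real.log θ - Real.log (2 * Real.pi * m)) - θ * ‖X‖ ^ 2 / (2 * m) := by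
  have hm : (0 : ℝ) < m := Nat.cast_pos.2 (NeZero.pos m)
  have hpos : 0 < θ / (2 * Real.pi * m) := by positivity
  rw [hyperplaneGaussian, Real.log_mul (by positivity) (Real.exp_ne_zero _),
    Real.log_mul (by positivity) (by positivity), Real.log_sqrt hm.le, Real.log_rpow hpos,
    Real.log_div hθ.ne' (by positivity), Real.log_exp]
  ring

lemma hyperplaneGaussian_le_hyperplaneGaussian_iff [NeZero m] {θ₁ θ₂ : ℝ} (hθ₁ : 0 < θ₁)
    (hθ₂ : 0 < θ₂) (X : EuclideanSpace ℝ (Fin m)) :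
    hyperplaneGaussian m θ₁ X ≤ hyperplaneGaussian m θ₂ X ↔
      (θ₂ - θ₁) * ‖X‖ ^ 2 ≤ m * (m - 1) * (Real.log θ₂ - Real.log θ₁) := by
  have hm : (0 : ℝ) < m := Nat.cast_pos.2 (NeZero.pos m)
  rw [← Real.log_le_log_iff (hyperplaneGaussian_pos hθ₁ X) (hyperplaneGaussian_pos hθ₂ X),
    log_hyperplaneGaussian hθ₁, log_hyperplaneGaussian hθ₂, ← sub_nonneg, ← sub_nonneg (a := _ * _)]
  have hdiff : Real.log m / 2 + ((m : ℝ) - 1) / 2 * (Real.log θ₂ - Real.log (2 * Real.pi * m)) -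
      θ₂ * ‖X‖ ^ 2 / (2 * m) - (Real.log m / 2 + ((m : ℝ) - 1) / 2 *
        (Real.log θ₁ - Real.log (2 * Real.pi * m)) - θ₁ * ‖X‖ ^ 2 / (2 * m)) =
      (m * (m - 1) * (Real.log θ₂ - Real.log θ₁) - (θ₂ - θ₁) * ‖X‖ ^ 2) / (2 * m) := by
    field_simp
    ring
  rw [hdiff, le_div_iff₀ (by positivity), zero_mul]

lemma hyperplaneGaussian_le_zero_apply [NeZero m] {θ : ℝ} (hθ : 0 < θ)
    (X : EuclideanSpace ℝ (Fin m)) : hyperplaneGaussian m θ X ≤ hyperplaneGaussian m θ 0 := by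
  have hm : (0 : ℝ) < m := Nat.cast_pos.2 (NeZero.pos m)
  rw [← Real.log_le_log_iff (hyperplaneGaussian_pos hθ X) (hyperplaneGaussian_pos hθ 0),
    log_hyperplaneGaussian hθ, log_hyperplaneGaussian hθ, norm_zero]
  have : 0 ≤ θ * ‖X‖ ^ 2 / (2 * m) := by positivity
  simp only [ne_eq, OfNat.ofNat_ne_zero, not_false_eq_true, zero_pow, mul_zero, zero_div, sub_zero]
  linarith

lemma hyperplaneGaussian_le_one {θ : ℝ} (hm : 2 ≤ m) (hθ : 0 < θ) (hθ' : θ ≤ 2 * Real.pi)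
    (X : EuclideanSpace ℝ (Fin m)) : hyperplaneGaussian m θ X ≤ 1 := by
  have : NeZero m := ⟨by omega⟩
  have hm2 : (2 : ℝ) ≤ m := by exact_mod_cast hm
  have hlog_m : 0 ≤ Real.log m := Real.log_nonneg (by linarith)
  have hlog_θ : Real.log θ ≤ Real.log (2 * Real.pi) := Real.log_le_log hθ hθ'
  refine (hyperplaneGaussian_le_zero_apply hθ X).trans ?_
  rw [← Real.log_nonpos_iff (hyperplaneGaussian_pos hθ 0).le, log_hyperplaneGaussian hθ, norm_zero,
    Real.log_mul (by positivity) (by positivity), zero_pow two_ne_zero, mul_zero, zero_div,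
    sub_zero]
  nlinarith [mul_nonneg (sub_nonneg.2 hm2) hlog_m,
    mul_nonneg (by linarith : 0 ≤ (m : ℝ) - 1) (sub_nonneg.2 hlog_θ)]

lemma contDiff_hyperplaneGaussian (m : ℕ) (θ : ℝ) : ContDiff ℝ 1 (hyperplaneGaussian m θ) :=
  contDiff_const.mul (((contDiff_const.mul (contDiff_norm_sq ℝ)).neg.div_const _).exp)

/-- The positive part of the difference of the two limiting Gaussian densities. -/
noncomputable def gaussianExcess (m : ℕ) (θ : ℝ) (X : EuclideanSpace ℝ (Fin m)) : ℝ :=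
  max (hyperplaneGaussian m θ X - hyperplaneGaussian m 1 X) 0

lemma continuous_gaussianExcess (m : ℕ) (θ : ℝ) : Continuous (gaussianExcess m θ) :=
  ((contDiff_hyperplaneGaussian m θ).continuous.sub
    (contDiff_hyperplaneGaussian m 1).continuous).max continuous_const

lemma exists_lipschitzOnWith_gaussianExcess (m : ℕ) (θ R : ℝ) :
    ∃ L, LipschitzOnWith L (gaussianExcess m θ) (Metric.closedBall 0 R) := by
  obtain ⟨L, hL⟩ := ((contDiff_hyperplaneGaussian m θ).sub
    (contDiff_hyperplaneGaussian m 1)).contDiffOn.exists_lipschitzOnWith one_ne_zero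
      (convex_closedBall 0 R) (isCompact_closedBall 0 R)
  exact ⟨1 * L, (LipschitzWith.id.max_const 0).comp_lipschitzOnWith hL⟩

lemma exists_gaussianExcess_eq_zero (m : ℕ) [NeZero m] {θ : ℝ} (hθ : 1 < θ) :
    ∃ R, ∀ X, R ≤ ‖X‖ → gaussianExcess m θ X = 0 := by
  refine ⟨Real.sqrt (m * (m - 1) * Real.log θ / (θ - 1)), fun X hX => ?_⟩
  have hX' := (div_le_iff₀ (by linarith)).1 (Real.sqrt_le_iff.1 hX).2
  refine max_eq_right (sub_nonpos.2 ?_)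
  rw [hyperplaneGaussian_le_hyperplaneGaussian_iff (by linarith) one_pos, Real.log_one]
  linarith

end Gaussian

section LocalLimit

variable {m : ℕ}

/-- The composition `l` of `n` in the coordinates of the central limit theorem. -/
noncomputable def scaledPoint (n : ℕ) (l : Fin m → ℕ) : EuclideanSpace ℝ (Fin m) :=
  WithLp.toLp 2 fun i => ((l i : ℝ) - n / m) * (m / Real.sqrt n)

/-- The volume of a lattice cell, for `hyperplaneMeasure m`, after the rescaling `scaledPoint`. -/
noncomputable def cellVolume (m n : ℕ) : ℝ := (m / Real.sqrt n) ^ (m - 1)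

lemma cellVolume_nonneg (m n : ℕ) : 0 ≤ cellVolume m n := by
  unfold cellVolume; positivity

lemma norm_scaledPoint_sq (n : ℕ) (l : Fin m → ℕ) :
    ‖scaledPoint n l‖ ^ 2 = (∑ i, ((l i : ℝ) - n / m) ^ 2) * (m ^ 2 / n) := by
  simp only [scaledPoint, EuclideanSpace.norm_sq_eq, Real.norm_eq_abs, sq_abs, mul_pow,
    ← Finset.sum_mul, div_pow, Real.sq_sqrt n.cast_nonneg]

lemma abs_sub_div_le_of_norm_scaledPoint_le [NeZero m] {n : ℕ} [NeZero n] {l : Fin m → ℕ} {R : ℝ}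
    (hR : ‖scaledPoint n l‖ ≤ R) (i : Fin m) :
    |(l i : ℝ) - n / m| ≤ R * Real.sqrt n / m := by
  have hm : (0 : ℝ) < m := Nat.cast_pos.2 (NeZero.pos m)
  have hn : 0 < Real.sqrt n := Real.sqrt_pos.2 (Nat.cast_pos.2 (NeZero.pos n))
  have hi := (PiLp.norm_apply_le (scaledPoint n l) i).trans hR
  rw [scaledPoint, PiLp.toLp_apply, Real.norm_eq_abs, abs_mul,
    abs_of_pos (div_pos hm hn), ← le_div_iff₀ (div_pos hm hn)] at hi
  exact hi.trans_eq (by field_simp)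

lemma sum_sub_div_eq_zero [NeZero m] {n : ℕ} {l : Fin m → ℕ} (hl : ∑ i, l i = n) :
    ∑ i, ((l i : ℝ) - n / m) = 0 := by
  have hm : (m : ℝ) ≠ 0 := NeZero.ne _
  rw [Finset.sum_sub_distrib, ← Nat.cast_sum, hl, Finset.sum_const, Finset.card_univ,
    Fintype.card_fin, nsmul_eq_mul, mul_div_cancel₀ _ hm, sub_self]

lemma log_multinomial {ι : Type*} (s : Finset ι) (l : ι → ℕ) :
    Real.log (Nat.multinomial s l) =
      Real.log (∑ i ∈ s, l i).factorial - ∑ i ∈ s, Real.log (l i).factorial := by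
  rw [← Nat.multinomial_spec s l]
  push_cast
  rw [Real.log_mul (Finset.prod_ne_zero_iff.2 fun i _ => by positivity)
    (by exact_mod_cast (Nat.multinomial_pos _ _).ne'), Real.log_prod (fun i _ => by positivity)]
  ring

lemma log_descFactorial {N k : ℕ} (h : k ≤ N) :
    Real.log (N.descFactorial k) = Real.log N.factorial - Real.log (N - k).factorial := by
  rw [← Nat.factorial_mul_descFactorial h, Nat.cast_mul, Real.log_mul (by positivity)
    (by exact_mod_cast (Nat.descFactorial_pos.2 h).ne')]
  ring

lemma multinomialMass_pos [NeZero m] {n : ℕ} {l : Fin m → ℕ} (hl : ∑ i, l i = n) :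
    0 < multinomialMass (fun _ : Fin m => 1 / (m : ℝ)) n l := by
  have hm : (0 : ℝ) < m := Nat.cast_pos.2 (NeZero.pos m)
  have hmult : (0 : ℝ) < Nat.multinomial Finset.univ l := Nat.cast_pos.2 (Nat.multinomial_pos _ _)
  rw [multinomialMass_const _ hl]
  positivity

lemma log_multinomialMass [NeZero m] {n : ℕ} {l : Fin m → ℕ} (hl : ∑ i, l i = n) :
    Real.log (multinomialMass (fun _ : Fin m => 1 / (m : ℝ)) n l) =
      Real.log n.factorial - ∑ i, Real.log (l i).factorial - n * Real.log m := by
  have hmult : (Nat.multinomial Finset.univ l : ℝ) ≠ 0 :=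
    Nat.cast_ne_zero.2 (Nat.multinomial_pos _ _).ne'
  have hm : (m : ℝ) ≠ 0 := NeZero.ne _
  rw [multinomialMass_const _ hl, Real.log_mul hmult (by positivity), log_multinomial, hl,
    Real.log_pow, one_div, Real.log_inv]
  ring

lemma le_mul_of_sum_eq {n K : ℕ} {l : Fin m → ℕ} (hl : ∑ i, l i = n) (hlK : ∀ i, l i ≤ K) :
    n ≤ m * K := by
  simpa [← hl] using Finset.sum_le_sum fun i (_ : i ∈ Finset.univ) => hlK i

lemma hypergeometricMass_pos {n K : ℕ} {l : Fin m → ℕ} (hl : ∑ i, l i = n) (hlK : ∀ i, l i ≤ K) :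
    0 < hypergeometricMass (fun _ : Fin m => K) n l := by
  have hnK : n ≤ ∑ _i : Fin m, K := hl ▸ Finset.sum_le_sum fun i _ => hlK i
  rw [hypergeometricMass, if_pos hl]
  exact div_pos (Finset.prod_pos fun i _ => Nat.cast_pos.2 (Nat.choose_pos (hlK i)))
    (Nat.cast_pos.2 (Nat.choose_pos hnK))

lemma log_hypergeometricMass_sub_log_multinomialMass [NeZero m] {n K : ℕ} {l : Fin m → ℕ}
    (hl : ∑ i, l i = n) (hlK : ∀ i, l i ≤ K) :
    Real.log (hypergeometricMass (fun _ : Fin m => K) n l) -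
        Real.log (multinomialMass (fun _ : Fin m => 1 / (m : ℝ)) n l) =
      m * Real.log K.factorial - ∑ i, Real.log (K - l i).factorial -
        Real.log (m * K).factorial + Real.log (m * K - n).factorial + n * Real.log m := by
  have hm : (m : ℝ) ≠ 0 := NeZero.ne _
  have hmult : (Nat.multinomial Finset.univ l : ℝ) ≠ 0 :=
    Nat.cast_ne_zero.2 (Nat.multinomial_pos _ _).ne'
  have hnK := le_mul_of_sum_eq hl hlK
  have hdesc : ∀ {N k : ℕ}, k ≤ N → (N.descFactorial k : ℝ) ≠ 0 := fun h =>
    Nat.cast_ne_zero.2 (Nat.descFactorial_pos.2 h).ne'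
  have hprod : ∏ i, (K.descFactorial (l i) : ℝ) ≠ 0 :=
    Finset.prod_ne_zero_iff.2 fun i _ => hdesc (hlK i)
  rw [hypergeometricMass_const K hl, multinomialMass_const _ hl, Fintype.card_fin,
    Real.log_mul hmult (div_ne_zero hprod (hdesc hnK)), Real.log_mul hmult (by positivity),
    Real.log_div hprod (hdesc hnK), Real.log_prod fun i _ => hdesc (hlK i),
    Finset.sum_congr rfl fun i _ => log_descFactorial (hlK i), log_descFactorial hnK, Real.log_pow,
    one_div, Real.log_inv, Finset.sum_sub_distrib, Finset.sum_const, Finset.card_univ,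
    Fintype.card_fin, nsmul_eq_mul]
  ring

lemma stirlingMain_multinomial {m n : ℝ} (hm : 0 < m) (hn : 0 < n) :
    stirlingMain n - m * stirlingMain (n / m) - n * Real.log m =
      -(m - 1) / 2 * (Real.log (2 * Real.pi) + Real.log n) + m / 2 * Real.log m := by
  simp only [stirlingMain]
  rw [Real.log_div hn.ne' hm.ne']
  field_simp
  ring

lemma stirlingMain_hypergeometric_ratio {m n c : ℝ} (hm : 0 < m) (hn : 0 < n) (hc : 1 < c) :
    m * stirlingMain (c * n / m) - m * stirlingMain ((c - 1) * n / m) - stirlingMain (c * n) +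
      stirlingMain ((c - 1) * n) + n * Real.log m = (m - 1) / 2 * Real.log (c / (c - 1)) := by
  have hc0 : 0 < c := by linarith
  have hc1 : 0 < c - 1 := by linarith
  simp only [stirlingMain]
  rw [Real.log_div (by positivity) hm.ne', Real.log_div (by positivity) hm.ne',
    Real.log_mul hc0.ne' hn.ne', Real.log_mul hc1.ne' hn.ne', Real.log_div hc0.ne' hc1.ne']
  field_simp
  ring

lemma exists_abs_log_factorial_sub_stirlingMain_le {α : ℝ} (hα : 0 < α) :
    ∃ C, ∀ᶠ n : ℕ in atTop, ∀ k : ℕ, (k : ℝ) = α * n →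
      |Real.log k.factorial - stirlingMain (α * n)| ≤ C / Real.sqrt n := by
  obtain ⟨C, hC⟩ := exists_abs_log_factorial_sub_stirlingTaylor_le hα 0
  refine ⟨C, hC.mono fun n hn k hk => ?_⟩
  simpa [stirlingTaylor, hk] using hn k (by simp [hk])

lemma log_cellVolume_mul_hyperplaneGaussian [NeZero m] {n : ℕ} (hn : n ≠ 0) {θ : ℝ} (hθ : 0 < θ)
    (X : EuclideanSpace ℝ (Fin m)) :
    Real.log (cellVolume m n * hyperplaneGaussian m θ X) =
      ((m : ℝ) - 1) / 2 * (Real.log θ - Real.log (2 * Real.pi) - Real.log n) + m / 2 * Real.log m -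
        θ * ‖X‖ ^ 2 / (2 * m) := by
  have hm : (m : ℝ) ≠ 0 := NeZero.ne _
  have hvol : cellVolume m n ≠ 0 := by unfold cellVolume; positivity
  rw [Real.log_mul hvol (hyperplaneGaussian_pos hθ X).ne', log_hyperplaneGaussian hθ, cellVolume,
    Real.log_pow, Nat.cast_pred (NeZero.pos m), Real.log_div hm (by positivity),
    Real.log_sqrt n.cast_nonneg, Real.log_mul (by positivity) hm]
  ring

lemma exists_abs_log_multinomialMass_sub_le (m : ℕ) [NeZero m] (R : ℝ) :
    ∃ C, ∀ᶠ n : ℕ in atTop, ∀ l : Fin m → ℕ, ∑ i, l i = n → ‖scaledPoint n l‖ ≤ R →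
      |Real.log (multinomialMass (fun _ : Fin m => 1 / (m : ℝ)) n l) -
        Real.log (cellVolume m n * hyperplaneGaussian m 1 (scaledPoint n l))| ≤
          C / Real.sqrt n := by
  have hm : (0 : ℝ) < m := Nat.cast_pos.2 (NeZero.pos m)
  obtain ⟨C₁, h₁⟩ := exists_abs_log_factorial_sub_stirlingMain_le one_pos
  obtain ⟨C₂, h₂⟩ := exists_abs_sum_log_factorial_sub_le (Fin m) (one_div_pos.2 hm) (R / m)
  refine ⟨C₁ + C₂, ?_⟩
  filter_upwards [h₁, h₂, eventually_ne_atTop 0] with n hn₁ hn₂ hn l hl hR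
  have : NeZero n := ⟨hn⟩
  have hn0 : (0 : ℝ) < n := by positivity
  simp only [one_mul, div_mul_eq_mul_div, Fintype.card_fin] at hn₁ hn₂
  have total := hn₁ n rfl
  have parts := hn₂ l (abs_sub_div_le_of_norm_scaledPoint_le hR) (sum_sub_div_eq_zero hl)
  have norm_sq : (∑ i, ((l i : ℝ) - n / m) ^ 2) / (2 * (n / m)) =
      ‖scaledPoint n l‖ ^ 2 / (2 * m) := by
    rw [norm_scaledPoint_sq]
    generalize ∑ i, ((l i : ℝ) - n / m) ^ 2 = S
    field_simp
  rw [norm_sq] at parts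
  rw [log_multinomialMass hl, log_cellVolume_mul_hyperplaneGaussian hn one_pos, Real.log_one,
    add_div]
  refine le_trans (le_of_eq ?_) ((abs_sub _ _).trans (add_le_add total parts))
  congr 1
  linear_combination stirlingMain_multinomial hm hn0

lemma natCast_eq_mul_div [NeZero m] {c : ℝ} {n K : ℕ} (hK : ((m * K : ℕ) : ℝ) = c * n) :
    (K : ℝ) = c * n / m := by
  rw [← hK, Nat.cast_mul, mul_div_cancel_left₀ _ (NeZero.ne _)]

lemma natCast_sub_sub_eq_neg [NeZero m] {c : ℝ} {n K k : ℕ} (hK : ((m * K : ℕ) : ℝ) = c * n)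
    (hkK : k ≤ K) : ((K - k : ℕ) : ℝ) - (c - 1) * n / m = -((k : ℝ) - n / m) := by
  rw [Nat.cast_sub hkK, natCast_eq_mul_div hK]
  ring

lemma eventually_le_of_norm_scaledPoint_le (m : ℕ) [NeZero m] {c : ℝ} (hc : 1 < c) (R : ℝ) :
    ∀ᶠ n : ℕ in atTop, ∀ (K : ℕ) (l : Fin m → ℕ), ((m * K : ℕ) : ℝ) = c * n →
      ‖scaledPoint n l‖ ≤ R → ∀ i, l i ≤ K := by
  have hm : (0 : ℝ) < m := Nat.cast_pos.2 (NeZero.pos m)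
  filter_upwards [eventually_ne_atTop 0, eventually_le_sqrt_natCast (R / (c - 1))]
    with n hn hRn K l hK hR i
  have : NeZero n := ⟨hn⟩
  have deviation := (le_abs_self _).trans (abs_sub_div_le_of_norm_scaledPoint_le hR i)
  have bound : R * Real.sqrt n ≤ (c - 1) * n := by
    calc R * Real.sqrt n ≤ Real.sqrt n * (c - 1) * Real.sqrt n := by
          gcongr
          exact (div_le_iff₀ (by linarith)).1 hRn
      _ = (c - 1) * n := by rw [mul_right_comm, Real.mul_self_sqrt n.cast_nonneg, mul_comm]
  rw [Nat.cast_mul] at hK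
  rw [← Nat.cast_le (α := ℝ), ← mul_le_mul_iff_right₀ hm, hK]
  rw [le_div_iff₀ hm, sub_mul, div_mul_cancel₀ _ hm.ne'] at deviation
  linarith

lemma exists_abs_sum_log_factorial_sub_sub_le (m : ℕ) [NeZero m] {c : ℝ} (hc : 1 < c) (R : ℝ) :
    ∃ C, ∀ᶠ n : ℕ in atTop, ∀ (K : ℕ) (l : Fin m → ℕ), ((m * K : ℕ) : ℝ) = c * n →
      ∑ i, l i = n → ‖scaledPoint n l‖ ≤ R →
      |∑ i, Real.log (K - l i).factorial - (m * stirlingMain ((c - 1) * n / m) +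
        ‖scaledPoint n l‖ ^ 2 / (2 * m * (c - 1)))| ≤ C / Real.sqrt n := by
  have hm : (0 : ℝ) < m := Nat.cast_pos.2 (NeZero.pos m)
  have hc1 : 0 < c - 1 := by linarith
  obtain ⟨C, hC⟩ := exists_abs_sum_log_factorial_sub_le (Fin m) (div_pos hc1 hm) (R / m)
  refine ⟨C, ?_⟩
  filter_upwards [hC, eventually_ne_atTop 0, eventually_le_of_norm_scaledPoint_le m hc R]
    with n hCn hn hnR K l hK hl hR
  have : NeZero n := ⟨hn⟩
  simp only [div_mul_eq_mul_div, Fintype.card_fin] at hCn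
  have complement := fun i => natCast_sub_sub_eq_neg hK (hnR K l hK hR i)
  have norm_sq : (∑ i, (((K - l i : ℕ) : ℝ) - (c - 1) * n / m) ^ 2) / (2 * ((c - 1) * n / m)) =
      ‖scaledPoint n l‖ ^ 2 / (2 * m * (c - 1)) := by
    simp only [complement, neg_sq, norm_scaledPoint_sq]
    generalize ∑ i, ((l i : ℝ) - n / m) ^ 2 = S
    field_simp
  rw [← norm_sq]
  refine hCn (fun i => K - l i) (fun i => ?_) ?_
  · rw [complement, abs_neg]
    exact abs_sub_div_le_of_norm_scaledPoint_le hR i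
  · simp only [complement, Finset.sum_neg_distrib, sum_sub_div_eq_zero hl, neg_zero]

lemma exists_abs_log_hypergeometricMass_sub_log_multinomialMass_sub_le (m : ℕ) [NeZero m] {c : ℝ}
    (hc : 1 < c) (R : ℝ) :
    ∃ C, ∀ᶠ n : ℕ in atTop, ∀ (K : ℕ) (l : Fin m → ℕ), ((m * K : ℕ) : ℝ) = c * n →
      ∑ i, l i = n → ‖scaledPoint n l‖ ≤ R →
      |Real.log (hypergeometricMass (fun _ : Fin m => K) n l) -
        Real.log (multinomialMass (fun _ : Fin m => 1 / (m : ℝ)) n l) -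
        (((m : ℝ) - 1) / 2 * Real.log (c / (c - 1)) -
          ‖scaledPoint n l‖ ^ 2 / (2 * m * (c - 1)))| ≤ C / Real.sqrt n := by
  have hm : (0 : ℝ) < m := Nat.cast_pos.2 (NeZero.pos m)
  have hc0 : 0 < c := by linarith
  have hc1 : 0 < c - 1 := by linarith
  obtain ⟨C₁, h₁⟩ := exists_abs_log_factorial_sub_stirlingMain_le (div_pos hc0 hm)
  obtain ⟨C₂, h₂⟩ := exists_abs_sum_log_factorial_sub_sub_le m hc R
  obtain ⟨C₃, h₃⟩ := exists_abs_log_factorial_sub_stirlingMain_le hc0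
  obtain ⟨C₄, h₄⟩ := exists_abs_log_factorial_sub_stirlingMain_le hc1
  refine ⟨m * C₁ + C₂ + C₃ + C₄, ?_⟩
  filter_upwards [h₁, h₂, h₃, h₄, eventually_ne_atTop 0,
    eventually_le_of_norm_scaledPoint_le m hc R] with n hn₁ hn₂ hn₃ hn₄ hn hnR K l hK hl hR
  have hlK := hnR K l hK hR
  have hnK := le_mul_of_sum_eq hl hlK
  simp only [div_mul_eq_mul_div] at hn₁
  have suit := hn₁ K (natCast_eq_mul_div hK)
  have remaining_suits := hn₂ K l hK hl hR
  have deck := hn₃ (m * K) hK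
  have remaining_deck := hn₄ (m * K - n) (by rw [Nat.cast_sub hnK, hK]; ring)
  rw [log_hypergeometricMass_sub_log_multinomialMass hl hlK,
    ← stirlingMain_hypergeometric_ratio hm (by positivity : (0 : ℝ) < n) hc, add_div, add_div,
    add_div, mul_div_assoc (m : ℝ) C₁]
  rw [abs_le] at suit remaining_suits deck remaining_deck ⊢
  have suit_ge := mul_le_mul_of_nonneg_left suit.1 hm.le
  have suit_le := mul_le_mul_of_nonneg_left suit.2 hm.le
  constructor <;> linarith

lemma exists_abs_log_hypergeometricMass_sub_le (m : ℕ) [NeZero m] {c : ℝ} (hc : 1 < c) (R : ℝ) :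
    ∃ C, ∀ᶠ n : ℕ in atTop, ∀ (K : ℕ) (l : Fin m → ℕ), ((m * K : ℕ) : ℝ) = c * n →
      ∑ i, l i = n → ‖scaledPoint n l‖ ≤ R →
      |Real.log (hypergeometricMass (fun _ : Fin m => K) n l) -
        Real.log (cellVolume m n * hyperplaneGaussian m (c / (c - 1)) (scaledPoint n l))| ≤
          C / Real.sqrt n := by
  have hm : (m : ℝ) ≠ 0 := NeZero.ne _
  have hc1 : 0 < c - 1 := by linarith
  obtain ⟨C₁, h₁⟩ := exists_abs_log_multinomialMass_sub_le m R
  obtain ⟨C₂, h₂⟩ := exists_abs_log_hypergeometricMass_sub_log_multinomialMass_sub_le m hc R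
  refine ⟨C₁ + C₂, ?_⟩
  filter_upwards [h₁, h₂, eventually_ne_atTop 0] with n hn₁ hn₂ hn K l hK hl hR
  have gaussian_ratio :
      Real.log (cellVolume m n * hyperplaneGaussian m (c / (c - 1)) (scaledPoint n l)) =
        Real.log (cellVolume m n * hyperplaneGaussian m 1 (scaledPoint n l)) +
          (((m : ℝ) - 1) / 2 * Real.log (c / (c - 1)) -
            ‖scaledPoint n l‖ ^ 2 / (2 * m * (c - 1))) := by
    rw [log_cellVolume_mul_hyperplaneGaussian hn (by positivity),
      log_cellVolume_mul_hyperplaneGaussian hn one_pos, Real.log_one]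
    field_simp
    ring
  rw [gaussian_ratio, add_div]
  refine le_trans (le_of_eq ?_)
    ((abs_add_le _ _).trans (add_le_add (hn₁ l hl hR) (hn₂ K l hK hl hR)))
  congr 1
  ring

lemma abs_sub_le_of_abs_log_sub_log_le {x y δ : ℝ} (hx : 0 < x) (hy : 0 < y)
    (h : |Real.log x - Real.log y| ≤ δ) (hδ : δ ≤ 1) : |x - y| ≤ 2 * δ * y := by
  have hxy : x - y = (Real.exp (Real.log x - Real.log y) - 1) * y := by
    rw [Real.exp_sub, Real.exp_log hx, Real.exp_log hy, sub_mul, div_mul_cancel₀ _ hy.ne', one_mul]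
  rw [hxy, abs_mul, abs_of_pos hy]
  gcongr
  exact (Real.abs_exp_sub_one_le (h.trans hδ)).trans (by gcongr)

lemma abs_sub_cellVolume_mul_hyperplaneGaussian_le [NeZero m] {n : ℕ} [NeZero n] {θ x C : ℝ}
    {X : EuclideanSpace ℝ (Fin m)} (hθ : 0 < θ) (hx : 0 < x)
    (hlog : |Real.log x - Real.log (cellVolume m n * hyperplaneGaussian m θ X)| ≤ C / Real.sqrt n)
    (hC : C ≤ Real.sqrt n) :
    |x - cellVolume m n * hyperplaneGaussian m θ X| ≤
      2 * C * hyperplaneGaussian m θ 0 / Real.sqrt n * cellVolume m n := by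
  have hn : (0 : ℝ) < n := Nat.cast_pos.2 (NeZero.pos n)
  have hm : (0 : ℝ) < m := Nat.cast_pos.2 (NeZero.pos m)
  have hv : 0 < cellVolume m n := by unfold cellVolume; positivity
  have hδ : 0 ≤ C / Real.sqrt n := (abs_nonneg _).trans hlog
  calc |x - cellVolume m n * hyperplaneGaussian m θ X|
      ≤ 2 * (C / Real.sqrt n) * (cellVolume m n * hyperplaneGaussian m θ X) :=
        abs_sub_le_of_abs_log_sub_log_le hx (mul_pos hv (hyperplaneGaussian_pos hθ X)) hlog
          (div_le_one_of_le₀ hC (Real.sqrt_nonneg _))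
    _ ≤ 2 * (C / Real.sqrt n) * (cellVolume m n * hyperplaneGaussian m θ 0) := by
        gcongr
        exact hyperplaneGaussian_le_zero_apply hθ X
    _ = 2 * C * hyperplaneGaussian m θ 0 / Real.sqrt n * cellVolume m n := by ring

/-- The contribution of the composition `l` to the distance of the hypergeometric law from the
multinomial law. -/
noncomputable def massExcess (n K : ℕ) (l : Fin m → ℕ) : ℝ :=
  max (hypergeometricMass (fun _ : Fin m => K) n l -
    multinomialMass (fun _ : Fin m => 1 / (m : ℝ)) n l) 0

lemma exists_abs_massExcess_sub_le (m : ℕ) [NeZero m] {c : ℝ} (hc : 1 < c) (R : ℝ) :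
    ∃ C, ∀ᶠ n : ℕ in atTop, ∀ (K : ℕ) (l : Fin m → ℕ), ((m * K : ℕ) : ℝ) = c * n →
      ∑ i, l i = n → ‖scaledPoint n l‖ ≤ R →
      |massExcess n K l - cellVolume m n * gaussianExcess m (c / (c - 1)) (scaledPoint n l)| ≤
        C / Real.sqrt n * cellVolume m n := by
  have hθ : 0 < c / (c - 1) := div_pos (by linarith) (by linarith)
  obtain ⟨C₁, h₁⟩ := exists_abs_log_multinomialMass_sub_le m R
  obtain ⟨C₂, h₂⟩ := exists_abs_log_hypergeometricMass_sub_le m hc R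
  refine ⟨2 * C₂ * hyperplaneGaussian m (c / (c - 1)) 0 + 2 * C₁ * hyperplaneGaussian m 1 0, ?_⟩
  filter_upwards [h₁, h₂, eventually_ne_atTop 0, eventually_le_sqrt_natCast C₁,
    eventually_le_sqrt_natCast C₂, eventually_le_of_norm_scaledPoint_le m hc R]
    with n hn₁ hn₂ hn hC₁ hC₂ hlK K l hK hl hR
  have : NeZero n := ⟨hn⟩
  have multinomial := abs_sub_cellVolume_mul_hyperplaneGaussian_le one_pos
    (multinomialMass_pos hl) (hn₁ l hl hR) hC₁
  have hypergeometric := abs_sub_cellVolume_mul_hyperplaneGaussian_le hθ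
    (hypergeometricMass_pos hl (hlK K l hK hR)) (hn₂ K l hK hl hR) hC₂
  rw [massExcess, gaussianExcess, mul_max_of_nonneg _ _ (cellVolume_nonneg m n), mul_zero, mul_sub,
    add_div, add_mul]
  refine (abs_max_sub_max_le_abs _ _ _).trans ?_
  rw [sub_sub_sub_comm]
  exact (abs_sub _ _).trans (add_le_add hypergeometric multinomial)

end LocalLimit

section Tail

variable {m : ℕ}

lemma log_factorial_le_stirlingMain_add_one {k : ℕ} (hk : k ≠ 0) :
    Real.log k.factorial ≤ stirlingMain k + 1 := by
  have h := (le_abs_self _).trans (abs_log_factorial_sub_stirlingMain_le hk)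
  have : 1 / (k : ℝ) ≤ 1 := by simpa using Nat.cast_inv_le_one k
  linarith

lemma le_sum_log_factorial_sub [NeZero m] {c : ℝ} {n K : ℕ} {l : Fin m → ℕ} (hc : 0 < c)
    (hn : 1 ≤ (c - 1) * n / m) (hK : ((m * K : ℕ) : ℝ) = c * n) (hl : ∑ i, l i = n)
    (hlK : ∀ i, l i ≤ K) :
    m * stirlingMain ((c - 1) * n / m) + ‖scaledPoint n l‖ ^ 2 / (2 * m * c) - m / 2 ≤
      ∑ i, Real.log (K - l i).factorial := by
  have hm : (0 : ℝ) < m := Nat.cast_pos.2 (NeZero.pos m)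
  have hn0 : (n : ℝ) ≠ 0 := by rintro h; norm_num [h] at hn
  have hK_eq := natCast_eq_mul_div hK
  have mean_le : (c - 1) * n / m ≤ K := by rw [hK_eq]; gcongr; linarith
  have pointwise := Finset.sum_le_sum fun i (_ : i ∈ Finset.univ) =>
    le_log_factorial_of_le hn mean_le (Nat.sub_le K (l i))
  refine le_trans (le_of_eq ?_) pointwise
  have norm_sq : ‖scaledPoint n l‖ ^ 2 / (2 * m * c) =
      (∑ i, ((l i : ℝ) - n / m) ^ 2) / (2 * K) := by
    rw [norm_scaledPoint_sq, hK_eq]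
    generalize ∑ i, ((l i : ℝ) - n / m) ^ 2 = S
    field_simp
  have expand : ∀ x : ℝ, -x * (-x + 1) = x ^ 2 - x := fun x => by ring
  simp only [natCast_sub_sub_eq_neg hK (hlK _), expand, Finset.sum_sub_distrib,
    Finset.sum_add_distrib, ← Finset.sum_mul, ← Finset.sum_div, Finset.sum_neg_distrib, norm_sq,
    sum_sub_div_eq_zero hl, Finset.sum_const, Finset.card_univ, Fintype.card_fin, nsmul_eq_mul]
  ring

lemma log_hypergeometricMass_sub_log_multinomialMass_le [NeZero m] {c : ℝ} {n K : ℕ}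
    {l : Fin m → ℕ} (hc : 1 < c) (hn : 1 ≤ (c - 1) * n / m) (hK : ((m * K : ℕ) : ℝ) = c * n)
    (hl : ∑ i, l i = n) (hlK : ∀ i, l i ≤ K) :
    Real.log (hypergeometricMass (fun _ : Fin m => K) n l) -
        Real.log (multinomialMass (fun _ : Fin m => 1 / (m : ℝ)) n l) ≤
      ((m : ℝ) - 1) / 2 * Real.log (c / (c - 1)) + 3 * m / 2 + 1 -
        ‖scaledPoint n l‖ ^ 2 / (2 * m * c) := by
  have hm : (0 : ℝ) < m := Nat.cast_pos.2 (NeZero.pos m)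
  have hc0 : 0 < c := by linarith
  have : 0 < c - 1 := by linarith
  have hn0 : (0 : ℝ) < n := Nat.cast_pos.2 (Nat.pos_of_ne_zero fun h => by norm_num [h] at hn)
  have hnK := le_mul_of_sum_eq hl hlK
  have hK_eq := natCast_eq_mul_div hK
  have remaining_eq : ((m * K - n : ℕ) : ℝ) = (c - 1) * n := by
    rw [Nat.cast_sub hnK, hK]; ring
  have suit := log_factorial_le_stirlingMain_add_one (k := K)
    (Nat.cast_ne_zero (R := ℝ).1 (by rw [hK_eq]; positivity))
  have deck := stirlingMain_le_log_factorial (k := m * K)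
    (Nat.cast_ne_zero (R := ℝ).1 (by rw [hK]; positivity))
  have remaining_deck := log_factorial_le_stirlingMain_add_one (k := m * K - n)
    (Nat.cast_ne_zero (R := ℝ).1 (by rw [remaining_eq]; positivity))
  have remaining_suits := le_sum_log_factorial_sub hc0 hn hK hl hlK
  rw [hK_eq] at suit
  rw [hK] at deck
  rw [remaining_eq] at remaining_deck
  rw [log_hypergeometricMass_sub_log_multinomialMass hl hlK,
    ← stirlingMain_hypergeometric_ratio hm hn0 hc]
  linarith [mul_le_mul_of_nonneg_left suit hm.le]

lemma hypergeometricMass_eq_zero {n K : ℕ} {l : Fin m → ℕ} {i : Fin m} (hi : K < l i) :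
    hypergeometricMass (fun _ : Fin m => K) n l = 0 := by
  rw [hypergeometricMass, Finset.prod_eq_zero (Finset.mem_univ i), zero_div, ite_self]
  rw [Nat.choose_eq_zero_of_lt hi, Nat.cast_zero]

lemma exists_massExcess_eq_zero (m : ℕ) [NeZero m] {c : ℝ} (hc : 1 < c) :
    ∃ R, ∀ᶠ n : ℕ in atTop, ∀ (K : ℕ) (l : Fin m → ℕ), ((m * K : ℕ) : ℝ) = c * n →
      ∑ i, l i = n → R ≤ ‖scaledPoint n l‖ → massExcess n K l = 0 := by
  have hm : (0 : ℝ) < m := Nat.cast_pos.2 (NeZero.pos m)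
  have : 0 < c := by linarith
  refine ⟨Real.sqrt ((((m : ℝ) - 1) / 2 * Real.log (c / (c - 1)) + 3 * m / 2 + 1) *
    (2 * m * c)), ?_⟩
  filter_upwards [(tendsto_natCast_atTop_atTop (R := ℝ)).eventually_ge_atTop (m / (c - 1))]
    with n hn K l hK hl hR
  refine max_eq_right (sub_nonpos.2 ?_)
  by_cases hlK : ∀ i, l i ≤ K
  · have mean_ge_one : 1 ≤ (c - 1) * n / m := by
      rw [one_le_div hm]
      exact (div_le_iff₀' (by linarith)).1 hn
    rw [← Real.log_le_log_iff (hypergeometricMass_pos hl hlK) (multinomialMass_pos hl),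
      ← sub_nonpos]
    refine (log_hypergeometricMass_sub_log_multinomialMass_le hc mean_ge_one hK hl hlK).trans ?_
    rw [sub_nonpos, le_div_iff₀ (by positivity)]
    exact (Real.sqrt_le_iff.1 hR).2
  · push Not at hlK
    obtain ⟨i, hi⟩ := hlK
    rw [hypergeometricMass_eq_zero hi]
    exact (multinomialMass_pos hl).le

end Tail

section HyperplanePoint

lemma hyperplanePoint_castSucc {p : ℕ} (y : Fin p → ℝ) (i : Fin p) :
    hyperplanePoint (p + 1) y i.castSucc = y i := by
  simp [hyperplanePoint]

lemma hyperplanePoint_last {p : ℕ} (y : Fin p → ℝ) :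
    hyperplanePoint (p + 1) y (Fin.last p) = -∑ j, y j := by
  simp [hyperplanePoint]

lemma hyperplanePoint_mem_hyperplane (m : ℕ) [NeZero m] (y : Fin (m - 1) → ℝ) :
    hyperplanePoint m y ∈ hyperplane m := by
  obtain ⟨p, rfl⟩ := Nat.exists_eq_succ_of_ne_zero (NeZero.ne m)
  change ∑ i, hyperplanePoint (p + 1) y i = 0
  rw [Fin.sum_univ_castSucc, hyperplanePoint_last,
    Finset.sum_congr rfl fun i _ => hyperplanePoint_castSucc (p := p) y i]
  exact add_neg_cancel _

lemma exists_lipschitzWith_hyperplanePoint (m : ℕ) : ∃ L, LipschitzWith L (hyperplanePoint m) := by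
  let f : (Fin (m - 1) → ℝ) →ₗ[ℝ] EuclideanSpace ℝ (Fin m) :=
    { toFun := hyperplanePoint m
      map_add' := fun y z => by
        ext i
        by_cases h : (i : ℕ) < m - 1 <;> simp [hyperplanePoint, h, Finset.sum_add_distrib, add_comm]
      map_smul' := fun a y => by
        ext i
        by_cases h : (i : ℕ) < m - 1 <;> simp [hyperplanePoint, h, Finset.mul_sum] }
  exact ⟨_, f.toContinuousLinearMap.lipschitz⟩

lemma antilipschitzWith_hyperplanePoint (m : ℕ) : AntilipschitzWith 1 (hyperplanePoint m) :=
  AntilipschitzWith.of_le_mul_dist fun y z => by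
    rw [NNReal.coe_one, one_mul, dist_pi_le_iff dist_nonneg]
    intro j
    have h := PiLp.norm_apply_le (hyperplanePoint m y - hyperplanePoint m z) ⟨j, by omega⟩
    simpa [hyperplanePoint, dist_eq_norm] using h

lemma isClosedEmbedding_hyperplanePoint (m : ℕ) : IsClosedEmbedding (hyperplanePoint m) := by
  obtain ⟨L, hL⟩ := exists_lipschitzWith_hyperplanePoint m
  exact (antilipschitzWith_hyperplanePoint m).isClosedEmbedding hL.uniformContinuous

lemma isCompact_preimage_hyperplanePoint_closedBall (m : ℕ) (R : ℝ) :
    IsCompact (hyperplanePoint m ⁻¹' Metric.closedBall 0 R) :=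
  (isClosedEmbedding_hyperplanePoint m).isCompact_preimage (isCompact_closedBall 0 R)

lemma integrable_gaussianExcess_comp_hyperplanePoint (m : ℕ) [NeZero m] {θ : ℝ} (hθ : 1 < θ) :
    Integrable fun y => gaussianExcess m θ (hyperplanePoint m y) := by
  obtain ⟨R, hR⟩ := exists_gaussianExcess_eq_zero m hθ
  have hcont :=
    (continuous_gaussianExcess m θ).comp (isClosedEmbedding_hyperplanePoint m).continuous
  refine hcont.integrable_of_hasCompactSupport (HasCompactSupport.intro
    (isCompact_preimage_hyperplanePoint_closedBall m R) fun y hy => hR _ (le_of_lt ?_))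
  simpa using hy

end HyperplanePoint

section Cells

variable {p n : ℕ} {l : Fin (p + 1) → ℕ} {y : Fin p → ℝ}

/-- The cube with corner `scaledPoint n l` in the first `p` coordinates and side `(p + 1) / √n`, the
mesh of the rescaled lattice. -/
def cell (n : ℕ) (l : Fin (p + 1) → ℕ) : Set (Fin p → ℝ) :=
  Set.univ.pi fun i => Set.Ico (scaledPoint n l i.castSucc)
    (scaledPoint n l i.castSucc + ((p + 1 : ℕ) : ℝ) / Real.sqrt n)

lemma measurableSet_cell (n : ℕ) (l : Fin (p + 1) → ℕ) : MeasurableSet (cell n l) :=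
  MeasurableSet.univ_pi fun _ => measurableSet_Ico

lemma volume_cell (n : ℕ) (l : Fin (p + 1) → ℕ) :
    volume (cell n l) = ENNReal.ofReal (cellVolume (p + 1) n) := by
  rw [cell, Real.volume_pi_Ico, cellVolume, ENNReal.ofReal_pow (by positivity)]
  simp

lemma mem_cell_iff (hn : n ≠ 0) : y ∈ cell n l ↔
    ∀ i, ⌊n / (p + 1 : ℕ) + y i * (Real.sqrt n / (p + 1 : ℕ))⌋ = (l i.castSucc : ℤ) := by
  have hm : (0 : ℝ) < (p + 1 : ℕ) := by positivity
  have hs : 0 < Real.sqrt n := by positivity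
  simp only [cell, Set.mem_univ_pi, Set.mem_Ico, scaledPoint, PiLp.toLp_apply, Int.floor_eq_iff,
    Int.cast_natCast]
  refine forall_congr' fun i => and_congr ?_ ?_
  · rw [← sub_le_iff_le_add', ← mul_div_assoc, ← mul_div_assoc, div_le_iff₀ hs, le_div_iff₀ hm]
  · rw [← lt_sub_iff_add_lt', ← mul_div_assoc, ← mul_div_assoc, ← add_div, lt_div_iff₀ hs,
      div_lt_iff₀ hm, ← add_one_mul, sub_add_eq_add_sub]

lemma eq_of_mem_cell (hn : n ≠ 0) {l' : Fin (p + 1) → ℕ} (hl : ∑ i, l i = n)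
    (hl' : ∑ i, l' i = n) (h : y ∈ cell n l) (h' : y ∈ cell n l') : l = l' := by
  rw [mem_cell_iff hn] at h h'
  have initial : ∀ i : Fin p, l i.castSucc = l' i.castSucc := fun i => by
    exact_mod_cast (h i).symm.trans (h' i)
  rw [Fin.sum_univ_castSucc] at hl hl'
  simp only [initial] at hl
  exact funext (Fin.lastCases (by omega) initial)

lemma exists_mem_cell (hn : n ≠ 0) (hy : ‖hyperplanePoint (p + 1) y‖ ≤ Real.sqrt n) :
    ∃ l : Fin (p + 1) → ℕ, ∑ i, l i = n ∧ y ∈ cell n l := by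
  have hm : (0 : ℝ) < (p + 1 : ℕ) := by positivity
  set X := hyperplanePoint (p + 1) y
  let t : Fin (p + 1) → ℝ := fun i => n / (p + 1 : ℕ) + X i * (Real.sqrt n / (p + 1 : ℕ))
  have t_nonneg : ∀ i, 0 ≤ t i := fun i => by
    have hXi := neg_le_of_abs_le ((PiLp.norm_apply_le X i).trans hy)
    have : t i = (Real.sqrt n + X i) * (Real.sqrt n / (p + 1 : ℕ)) := by
      rw [add_mul, ← mul_div_assoc, Real.mul_self_sqrt n.cast_nonneg]
    rw [this]
    exact mul_nonneg (by linarith) (by positivity)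
  have t_sum : ∑ i, t i = n := by
    have : ∑ i, X i = 0 := hyperplanePoint_mem_hyperplane (p + 1) y
    rw [Finset.sum_add_distrib, ← Finset.sum_mul, this, Finset.sum_const, Finset.card_univ,
      Fintype.card_fin, nsmul_eq_mul, mul_div_cancel₀ _ hm.ne', zero_mul, add_zero]
  have floor_sum : ∑ i : Fin p, ⌊t i.castSucc⌋₊ ≤ n := by
    rw [← Nat.cast_le (α := ℝ), ← t_sum, Fin.sum_univ_castSucc, Nat.cast_sum]
    exact (Finset.sum_le_sum fun i _ => Nat.floor_le (t_nonneg _)).trans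
      (le_add_of_nonneg_right (t_nonneg _))
  refine ⟨Fin.snoc (α := fun _ => ℕ) (fun i => ⌊t i.castSucc⌋₊) (n - ∑ i : Fin p, ⌊t i.castSucc⌋₊),
    ?_, (mem_cell_iff hn).2 fun i => ?_⟩
  · simp only [Fin.sum_univ_castSucc, Fin.snoc_castSucc, Fin.snoc_last]
    omega
  · rw [Fin.snoc_castSucc, Int.natCast_floor_eq_floor (t_nonneg _), ← hyperplanePoint_castSucc y i]

lemma hyperplanePoint_scaledPoint (hl : ∑ i, l i = n) :
    hyperplanePoint (p + 1) (fun i : Fin p => scaledPoint n l i.castSucc) = scaledPoint n l := by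
  have hsum : ∑ i, scaledPoint n l i = 0 := by
    simp only [scaledPoint, PiLp.toLp_apply, ← Finset.sum_mul, sum_sub_div_eq_zero hl, zero_mul]
  rw [Fin.sum_univ_castSucc] at hsum
  ext i
  refine Fin.lastCases ?_ (fun j => ?_) i
  · rw [hyperplanePoint_last]
    linarith
  · rw [hyperplanePoint_castSucc]

lemma exists_dist_scaledPoint_hyperplanePoint_le (p : ℕ) :
    ∃ C, 0 ≤ C ∧ ∀ (n : ℕ) (l : Fin (p + 1) → ℕ) (y : Fin p → ℝ), ∑ i, l i = n → y ∈ cell n l →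
      dist (scaledPoint n l) (hyperplanePoint (p + 1) y) ≤ C / Real.sqrt n := by
  obtain ⟨L, hL⟩ := exists_lipschitzWith_hyperplanePoint (p + 1)
  refine ⟨L * (p + 1 : ℕ), by positivity, fun n l y hl hy => ?_⟩
  rw [← hyperplanePoint_scaledPoint hl, mul_div_assoc]
  refine (hL.dist_le_mul _ _).trans ?_
  gcongr
  refine (dist_pi_le_iff (by positivity)).2 fun i => ?_
  obtain ⟨corner_le, lt_corner⟩ := hy i (Set.mem_univ i)
  rw [Real.dist_eq, abs_le]
  constructor <;> linarith [show 0 ≤ ((p + 1 : ℕ) : ℝ) / Real.sqrt n by positivity]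

end Cells

section RiemannSum

lemma abs_sum_sub_integral_le {Ω ι : Type*} [MeasurableSpace Ω] {ν : Measure Ω} {s : Finset ι}
    {A : ι → Set Ω} {B : Set Ω} {f : Ω → ℝ} {w : ι → ℝ} {ε : ℝ} (hε : 0 ≤ ε)
    (hA : ∀ i ∈ s, MeasurableSet (A i)) (hAfin : ∀ i ∈ s, ν (A i) ≠ ⊤)
    (hdisj : (s : Set ι).PairwiseDisjoint A) (hB : MeasurableSet B) (hBfin : ν B ≠ ⊤)
    (hf : Integrable f ν) (hf_zero : ∀ y, y ∉ ⋃ i ∈ s, A i → f y = 0)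
    (happrox : ∀ i ∈ s, ∀ y ∈ A i, |w i - f y| ≤ B.indicator (fun _ => ε) y) :
    |∑ i ∈ s, ν.real (A i) * w i - ∫ y, f y ∂ν| ≤ ε * ν.real B := by
  have hB_int : Integrable (B.indicator fun _ => ε) ν :=
    (integrable_indicator_iff hB).2 (integrableOn_const hBfin)
  have split : ∑ i ∈ s, ν.real (A i) * w i - ∫ y, f y ∂ν = ∑ i ∈ s, ∫ y in A i, (w i - f y) ∂ν := by
    rw [← setIntegral_eq_integral_of_forall_compl_eq_zero hf_zero,
      integral_biUnion_finset s hA hdisj fun i _ => hf.integrableOn, ← Finset.sum_sub_distrib]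
    refine Finset.sum_congr rfl fun i hi => ?_
    have hw : IntegrableOn (fun _ => w i) (A i) ν := integrableOn_const (hAfin i hi)
    rw [integral_sub hw hf.integrableOn, setIntegral_const, smul_eq_mul]
  calc |∑ i ∈ s, ν.real (A i) * w i - ∫ y, f y ∂ν|
      ≤ ∑ i ∈ s, |∫ y in A i, (w i - f y) ∂ν| := split ▸ Finset.abs_sum_le_sum_abs _ _
    _ ≤ ∑ i ∈ s, ∫ y in A i, B.indicator (fun _ => ε) y ∂ν :=
        Finset.sum_le_sum fun i hi => by
          rw [← Real.norm_eq_abs]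
          exact norm_integral_le_of_norm_le hB_int.integrableOn
            ((ae_restrict_iff' (hA i hi)).2 (ae_of_all _ (happrox i hi)))
    _ = ∫ y in ⋃ i ∈ s, A i, B.indicator (fun _ => ε) y ∂ν :=
        (integral_biUnion_finset s hA hdisj fun i _ => hB_int.integrableOn).symm
    _ ≤ ∫ y, B.indicator (fun _ => ε) y ∂ν :=
        setIntegral_le_integral hB_int (ae_of_all _ (Set.indicator_nonneg fun _ _ => hε))
    _ = ε * ν.real B := by
        rw [integral_indicator hB, setIntegral_const, smul_eq_mul, mul_comm]

lemma abs_sum_cellVolume_mul_sub_integral_le {p n : ℕ} (hn : n ≠ 0) {R ε : ℝ} (hR : R ≤ Real.sqrt n)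
    (hε : 0 ≤ ε) {f : (Fin p → ℝ) → ℝ} (hf : Integrable f)
    (hf_zero : ∀ y, R < ‖hyperplanePoint (p + 1) y‖ → f y = 0) {w : (Fin (p + 1) → ℕ) → ℝ}
    (happrox : ∀ l y, ∑ i, l i = n → y ∈ cell n l → |w l - f y| ≤
      (hyperplanePoint (p + 1) ⁻¹' Metric.closedBall 0 R).indicator (fun _ => ε) y) :
    |∑ l ∈ Finset.piAntidiag Finset.univ n, cellVolume (p + 1) n * w l - ∫ y, f y| ≤
      ε * volume.real (hyperplanePoint (p + 1) ⁻¹' Metric.closedBall 0 R) := by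
  have hsum : ∀ l, l ∈ Finset.piAntidiag (Finset.univ : Finset (Fin (p + 1))) n ↔
      ∑ i, l i = n := fun l => by simp
  have hB := isCompact_preimage_hyperplanePoint_closedBall (p + 1) R
  have hvolume : ∀ l : Fin (p + 1) → ℕ, volume.real (cell n l) = cellVolume (p + 1) n := fun l => by
    rw [measureReal_def, volume_cell, ENNReal.toReal_ofReal (cellVolume_nonneg _ n)]
  rw [Finset.sum_congr rfl fun l _ => by rw [← hvolume l]]
  refine abs_sum_sub_integral_le hε (fun l _ => measurableSet_cell n l)
    (fun l _ => by rw [volume_cell]; exact ENNReal.ofReal_ne_top)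
    (fun l hl l' hl' hne => Set.disjoint_left.2 fun y hy hy' =>
      hne (eq_of_mem_cell hn ((hsum l).1 hl) ((hsum l').1 hl') hy hy'))
    hB.measurableSet hB.measure_lt_top.ne hf (fun y hy => hf_zero y (lt_of_not_ge fun hyR => hy ?_))
    (fun l hl y hy => happrox l y ((hsum l).1 hl) hy)
  obtain ⟨l, hl, hyl⟩ := exists_mem_cell hn (hyR.trans hR)
  exact Set.mem_biUnion ((hsum l).2 hl) hyl

lemma exists_abs_massExcess_div_sub_gaussianExcess_le (p : ℕ) {c : ℝ} (hc : 1 < c) :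
    ∃ R C, 0 ≤ C ∧ (∀ X, R < ‖X‖ → gaussianExcess (p + 1) (c / (c - 1)) X = 0) ∧
      ∀ᶠ n : ℕ in atTop, ∀ (K : ℕ) (l : Fin (p + 1) → ℕ) (y : Fin p → ℝ),
        (((p + 1) * K : ℕ) : ℝ) = c * n → ∑ i, l i = n → y ∈ cell n l →
        |massExcess n K l / cellVolume (p + 1) n -
          gaussianExcess (p + 1) (c / (c - 1)) (hyperplanePoint (p + 1) y)| ≤
        (hyperplanePoint (p + 1) ⁻¹' Metric.closedBall 0 R).indicator
          (fun _ => C / Real.sqrt n) y := by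
  have hθ : 1 < c / (c - 1) := (one_lt_div (by linarith)).2 (by linarith)
  obtain ⟨R₁, massExcess_zero⟩ := exists_massExcess_eq_zero (p + 1) hc
  obtain ⟨R₂, gaussianExcess_zero⟩ := exists_gaussianExcess_eq_zero (p + 1) hθ
  obtain ⟨C₁, hC₁, corner_dist⟩ := exists_dist_scaledPoint_hyperplanePoint_le p
  obtain ⟨L, lipschitz⟩ :=
    exists_lipschitzOnWith_gaussianExcess (p + 1) (c / (c - 1)) (max R₁ R₂ + 2)
  obtain ⟨C₂, local_limit⟩ := exists_abs_massExcess_sub_le (p + 1) hc (max R₁ R₂ + 2)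
  refine ⟨max R₁ R₂ + 1, max C₂ 0 + L * C₁, by positivity, fun X hX => ?_, ?_⟩
  · exact gaussianExcess_zero X (by linarith [le_max_right R₁ R₂])
  filter_upwards [massExcess_zero, local_limit, eventually_ne_atTop 0,
    eventually_le_sqrt_natCast C₁] with n massExcess_zero local_limit hn hnC₁ K l y hK hl hy
  have hdist := corner_dist n l y hl hy
  have hdist_le_one : dist (scaledPoint n l) (hyperplanePoint (p + 1) y) ≤ 1 :=
    hdist.trans (div_le_one_of_le₀ hnC₁ (Real.sqrt_nonneg _))
  have norm_sub := abs_le.1 <|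
    (abs_norm_sub_norm_le _ _).trans (dist_eq_norm (scaledPoint n l) _ ▸ hdist_le_one)
  by_cases hball : ‖hyperplanePoint (p + 1) y‖ ≤ max R₁ R₂ + 1
  · have hv : 0 < cellVolume (p + 1) n := by unfold cellVolume; positivity
    have mass := local_limit K l hK hl (by linarith)
    have gaussian := lipschitz.dist_le_mul (scaledPoint n l)
      (mem_closedBall_zero_iff.2 (by linarith)) (hyperplanePoint (p + 1) y)
      (mem_closedBall_zero_iff.2 (by linarith))
    rw [Set.indicator_of_mem (Set.mem_preimage.2 (mem_closedBall_zero_iff.2 hball)),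
      add_div]
    refine (abs_sub_le _ (gaussianExcess (p + 1) (c / (c - 1)) (scaledPoint n l)) _).trans
      (add_le_add ?_ (gaussian.trans ?_))
    · rw [div_sub' hv.ne', abs_div, abs_of_pos hv, div_le_iff₀ hv]
      exact mass.trans (by gcongr; exact le_max_left _ _)
    · rw [mul_div_assoc]
      gcongr
  · rw [massExcess_zero K l hK hl (by linarith [le_max_left R₁ R₂]),
      gaussianExcess_zero _ (by linarith [le_max_right R₁ R₂]), zero_div, sub_zero, abs_zero]
    exact Set.indicator_nonneg (fun _ _ => by positivity) y

theorem exists_abs_tvDist_sub_integral_gaussianExcess_le (m : ℕ) [NeZero m] {c : ℝ} (hc : 1 < c) :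
    ∃ C, ∀ᶠ n : ℕ in atTop, ∀ K : ℕ, ((m * K : ℕ) : ℝ) = c * n →
      |tvDist (hypergeometricMass (fun _ : Fin m => K) n)
          (multinomialMass (fun _ : Fin m => 1 / (m : ℝ)) n) -
        ∫ X, gaussianExcess m (c / (c - 1)) X ∂hyperplaneMeasure m| ≤ C / Real.sqrt n := by
  obtain ⟨p, rfl⟩ := Nat.exists_eq_succ_of_ne_zero (NeZero.ne m)
  obtain ⟨R, C, hC, gaussianExcess_zero, happrox⟩ :=
    exists_abs_massExcess_div_sub_gaussianExcess_le p hc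
  have hθ : 1 < c / (c - 1) := (one_lt_div (by linarith)).2 (by linarith)
  refine ⟨C * volume.real (hyperplanePoint (p + 1) ⁻¹' Metric.closedBall 0 R), ?_⟩
  filter_upwards [happrox, eventually_ne_atTop 0, eventually_le_sqrt_natCast R]
    with n happrox hn hnR K hK
  have hv : cellVolume (p + 1) n ≠ 0 := by unfold cellVolume; positivity
  have riemann := abs_sum_cellVolume_mul_sub_integral_le (p := p) hn hnR
    (by positivity : 0 ≤ C / Real.sqrt n)
    (integrable_gaussianExcess_comp_hyperplanePoint (p + 1) hθ)
    (fun y hy => gaussianExcess_zero _ hy) fun l y hl hy => happrox K l y hK hl hy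
  simp only [mul_div_cancel₀ _ hv] at riemann
  rwa [hyperplaneMeasure, (isClosedEmbedding_hyperplanePoint _).measurableEmbedding.integral_map,
    tvDist_hypergeometric_multinomial_eq_sum, mul_div_right_comm]

end RiemannSum

section Profile

variable {d : ℕ} [NeZero d] {c : ℝ}

lemma sqrt_mul_rpow_eq {θ : ℝ} (hθ : 0 < θ) :
    Real.sqrt (2 * d : ℕ) * (θ / (2 * Real.pi * (2 * d : ℕ))) ^ ((((2 * d : ℕ) : ℝ) - 1) / 2) =
      Real.pi ^ (1 / 2 - (d : ℝ)) * (2 : ℝ) ^ (3 / 2 - 2 * (d : ℝ)) * (d : ℝ) ^ (1 - (d : ℝ)) *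
        θ ^ ((d : ℝ) - 1 / 2) := by
  have hd : (0 : ℝ) < d := Nat.cast_pos.2 (NeZero.pos d)
  push_cast
  have hlog : Real.log (θ / (2 * Real.pi * (2 * d))) =
      Real.log θ - (2 * Real.log 2 + Real.log Real.pi + Real.log d) := by
    rw [Real.log_div hθ.ne' (by positivity), Real.log_mul (by positivity) (by positivity),
      Real.log_mul two_ne_zero Real.pi_pos.ne', Real.log_mul two_ne_zero hd.ne']
    ring
  rw [Real.sqrt_eq_rpow, Real.rpow_def_of_pos (by positivity), Real.rpow_def_of_pos (by positivity),
    Real.rpow_def_of_pos Real.pi_pos, Real.rpow_def_of_pos two_pos, Real.rpow_def_of_pos hd,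
    Real.rpow_def_of_pos hθ, hlog, Real.log_mul two_ne_zero hd.ne',
    ← Real.exp_add, ← Real.exp_add, ← Real.exp_add, ← Real.exp_add]
  ring_nf

lemma profile_eq_hyperplaneGaussian_sub (hc : 1 < c) (X : EuclideanSpace ℝ (Fin (2 * d))) :
    profile d c X =
      hyperplaneGaussian (2 * d) (c / (c - 1)) X - hyperplaneGaussian (2 * d) 1 X := by
  have hd : (d : ℝ) ≠ 0 := NeZero.ne _
  have hc1 : 0 < c - 1 := by linarith
  rw [profile, hyperplaneGaussian, hyperplaneGaussian, sqrt_mul_rpow_eq (by positivity),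
    sqrt_mul_rpow_eq one_pos, Real.one_rpow, mul_one, mul_assoc _ (_ ^ _) (Real.exp _), ← mul_sub]
  push_cast
  congr 4 <;> field_simp <;> ring

lemma profile_le_one (hc : 2 ≤ c) (X : EuclideanSpace ℝ (Fin (2 * d))) : profile d c X ≤ 1 := by
  have hc1 : 0 < c - 1 := by linarith
  have hθ : c / (c - 1) ≤ 2 * Real.pi := by
    rw [div_le_iff₀ hc1]
    nlinarith [Real.pi_gt_three]
  rw [profile_eq_hyperplaneGaussian_sub (by linarith)]
  linarith [hyperplaneGaussian_le_one (by have := NeZero.pos d; omega) (by positivity) hθ X,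
    hyperplaneGaussian_pos one_pos X]

lemma radius_sq (hc : 1 < c) :
    radius d c ^ 2 = (2 * d : ℕ) * ((2 * d : ℕ) - 1) * (c - 1) * Real.log (c / (c - 1)) := by
  have hd : (1 : ℝ) ≤ d := Nat.one_le_cast.2 (NeZero.pos d)
  have hlog : 0 ≤ Real.log (c / (c - 1)) := Real.log_nonneg <| by
    rw [le_div_iff₀ (by linarith)]
    linarith
  have hdim : 0 ≤ 4 * (d : ℝ) ^ 2 - 2 * d := by nlinarith
  rw [radius, Real.sq_sqrt (mul_nonneg (mul_nonneg hdim (by linarith)) hlog)]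
  push_cast
  ring

lemma mem_region_iff (hc : 1 < c) (X : EuclideanSpace ℝ (Fin (2 * d))) :
    X ∈ region d c ↔ 0 ≤ profile d c X ∧ X ∈ hyperplane (2 * d) := by
  have hc1 : 0 < c - 1 := by linarith
  have hθ : c / (c - 1) - 1 = 1 / (c - 1) := by field_simp; ring
  rw [profile_eq_hyperplaneGaussian_sub hc, sub_nonneg,
    hyperplaneGaussian_le_hyperplaneGaussian_iff one_pos (by positivity), Real.log_one, sub_zero,
    hθ, one_div_mul_eq_div, div_le_iff₀ hc1, mul_right_comm, ← radius_sq hc, region,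
    Set.mem_inter_iff, mem_closedBall_zero_iff,
    pow_le_pow_iff_left₀ (norm_nonneg X) (show 0 ≤ radius d c from Real.sqrt_nonneg _) two_ne_zero]

lemma isClosed_region (d : ℕ) (c : ℝ) : IsClosed (region d c) :=
  Metric.isClosed_closedBall.inter (isClosed_eq (by fun_prop) continuous_const)

lemma integrableOn_profile_region (d : ℕ) (c : ℝ) :
    IntegrableOn (profile d c) (region d c) (hyperplaneMeasure (2 * d)) := by
  have embedding := isClosedEmbedding_hyperplanePoint (2 * d)
  have hcont : Continuous (profile d c) := by unfold profile; fun_prop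
  rw [hyperplaneMeasure, embedding.measurableEmbedding.integrableOn_map_iff]
  exact ((hcont.comp embedding.continuous).continuousOn.integrableOn_compact
    (isCompact_preimage_hyperplanePoint_closedBall _ (radius d c))).mono_set
      (Set.preimage_mono Set.inter_subset_left)

lemma integral_gaussianExcess_eq_setIntegral_profile (hc : 1 < c) :
    ∫ X, gaussianExcess (2 * d) (c / (c - 1)) X ∂hyperplaneMeasure (2 * d) =
      ∫ X in region d c, profile d c X ∂hyperplaneMeasure (2 * d) := by
  rw [← integral_indicator (isClosed_region d c).measurableSet]
  refine integral_congr_ae ?_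
  rw [EventuallyEq, hyperplaneMeasure,
    (isClosedEmbedding_hyperplanePoint _).measurableEmbedding.ae_map_iff]
  refine ae_of_all _ fun y => ?_
  have hy := hyperplanePoint_mem_hyperplane (2 * d) y
  rw [gaussianExcess, ← profile_eq_hyperplaneGaussian_sub hc]
  by_cases hpos : 0 ≤ profile d c (hyperplanePoint (2 * d) y)
  · rw [Set.indicator_of_mem ((mem_region_iff hc _).2 ⟨hpos, hy⟩), max_eq_left hpos]
  · rw [Set.indicator_of_notMem fun h => hpos ((mem_region_iff hc _).1 h).1,
      max_eq_right (not_le.1 hpos).le]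

end Profile

end CardDeck

theorem theorem1_general (d : ℕ) [NeZero d] (c : ℝ) (hc : 1 < c) :
    (∀ (n K : ℕ) (h : n ≤ 2 * d * K),
      CardDeck.deckDist d n (2 * d * K) h =
        CardDeck.tvDist (CardDeck.hypergeometricMass (fun _ : Fin (2 * d) => K) n)
          (CardDeck.multinomialMass (fun _ : Fin (2 * d) => 1 / (2 * (d : ℝ))) n)) ∧
    Set.MapsTo (CardDeck.profile d c) (CardDeck.region d c) (Set.Ici 0) ∧
    MeasureTheory.IntegrableOn (CardDeck.profile d c) (CardDeck.region d c)
      (CardDeck.hyperplaneMeasure (2 * d)) ∧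
    ∃ C : ℝ, 0 < C ∧ ∃ n₀ : ℕ, ∀ n : ℕ, n₀ ≤ n →
      ∀ (K : ℕ) (h : n ≤ 2 * d * K), ((2 * d * K : ℕ) : ℝ) = c * n →
        |CardDeck.deckDist d n (2 * d * K) h -
            ∫ X in CardDeck.region d c, CardDeck.profile d c X
              ∂(CardDeck.hyperplaneMeasure (2 * d))| ≤ C / Real.sqrt n := by
  refine ⟨CardDeck.deckDist_eq_tvDist d, fun X hX => ((CardDeck.mem_region_iff hc X).1 hX).1,
    CardDeck.integrableOn_profile_region d c, ?_⟩
  obtain ⟨C, hC⟩ := CardDeck.exists_abs_tvDist_sub_integral_gaussianExcess_le (2 * d) hc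
  obtain ⟨n₀, hn₀⟩ := Filter.eventually_atTop.1 hC
  refine ⟨max C 1, by positivity, n₀, fun n hn K h hK => ?_⟩
  have bound := hn₀ n hn K hK
  rw [CardDeck.integral_gaussianExcess_eq_setIntegral_profile hc, Nat.cast_mul, Nat.cast_two,
    ← CardDeck.deckDist_eq_tvDist d n K h] at bound
  exact bound.trans (by gcongr; exact le_max_left C 1)

theorem theorem1 (d : ℕ) [NeZero d] (c : ℝ) (hc : 2 * (d : ℝ) ≤ c) :
    (∀ (n K : ℕ) (h : n ≤ 2 * d * K),
      CardDeck.deckDist d n (2 * d * K) h =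
        CardDeck.tvDist (CardDeck.hypergeometricMass (fun _ : Fin (2 * d) => K) n)
          (CardDeck.multinomialMass (fun _ : Fin (2 * d) => 1 / (2 * (d : ℝ))) n)) ∧
    Set.MapsTo (CardDeck.profile d c) (CardDeck.region d c) (Set.Icc 0 1) ∧
    MeasureTheory.IntegrableOn (CardDeck.profile d c) (CardDeck.region d c)
      (CardDeck.hyperplaneMeasure (2 * d)) ∧
    ∃ C : ℝ, 0 < C ∧ ∃ n₀ : ℕ, ∀ n : ℕ, n₀ ≤ n →
      ∀ (K : ℕ) (h : n ≤ 2 * d * K), ((2 * d * K : ℕ) : ℝ) = c * n →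
        |CardDeck.deckDist d n (2 * d * K) h -
            ∫ X in CardDeck.region d c, CardDeck.profile d c X
              ∂(CardDeck.hyperplaneMeasure (2 * d))| ≤ C / Real.sqrt n := by
  have hd : (1 : ℝ) ≤ d := Nat.one_le_cast.2 (NeZero.pos d)
  obtain ⟨deckDist_eq, profile_nonneg, rest⟩ := theorem1_general d c (by linarith)
  exact ⟨deckDist_eq,
    fun X hX => ⟨profile_nonneg hX, CardDeck.profile_le_one (by linarith) X⟩, rest⟩
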